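/- Let $p$ and $q$ be distinct odd primes and put $N=pq$. Let $\mathbb{H}^*=\mathbb{H}\cup\mathbb{P}^1(\mathbb{Q})$ be the extended upper half-plane with its horoball topology, let $X_0(N)=\Gamma_0(N)\backslash\mathbb{H}^*$ carry the quotient topology, and write $\pi:\mathbb{H}^*\to X_0(N)$ for the projection; the points of $\pi(\mathbb{P}^1(\mathbb{Q}))$ are the cusps. The reflection $\sigma(z)=-\bar z$ of $\mathbb{H}$ (with $\sigma(r)=-r$ for $r\in\mathbb{Q}$ and $\sigma(\infty)=\infty$) normalizes the action of $\Gamma_0(N)$ and so induces an involution of $X_0(N)$, again denoted $\sigma$. Let $\mathrm{Fix}(\sigma)\subset X_0(N)$ be its set of fixed points. (i) $\mathrm{Fix}(\sigma)$ contains all cusps and is a disjoint union $\mathcal{C}_1\cup\mathcal{C}_3$ of two simple closed curves (subsets homeomorphic to the circle), each containing exactly two cusps: the cusps on $\mathcal{C}_1$ are the two distinct points $\pi(\infty),\pi(0)$, and those on $\mathcal{C}_3$ are the two distinct points $\pi(1/p),\pi(1/q)$. (ii) There are complete geodesics $G_1,G_1'$ and $G_3,G_3'$ of $\mathbb{H}$,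 with endpoints in $\mathbb{P}^1(\mathbb{Q})=\mathbb{Q}\cup\{\infty\}$, such that the four geodesics are pairwise disjoint in $\mathbb{H}$; for $i=1,3$ the curve $\mathcal{C}_i$ is the image under $\pi$ of $G_i\cup G_i'$ together with their endpoints; $\pi$ is injective on $G_1\cup G_1'\cup G_3\cup G_3'$; and for $i=1,3$ the two endpoints of $G_i$ can be labelled $a_i,b_i$ and those of $G_i'$ labelled $a_i',b_i'$ so that $a_i'\in\Gamma_0(N)a_i$ and $b_i'\in\Gamma_0(N)b_i$. -/

import Mathlib

open scoped UpperHalfPlane MatrixGroups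

noncomputable section

namespace ModCurve

/-- The action of `SL(2, ℤ)` on `P¹(ℚ) = ℚ ∪ {∞}` by fractional linear transformations
(Mathlib's action of `GL(2, ℚ)` on `OnePoint ℚ`). -/
def moveCusp (g : SL(2, ℤ)) (c : OnePoint ℚ) : OnePoint ℚ :=
  Matrix.SpecialLinearGroup.mapGL ℚ g • c

/-- The extended upper half-plane `ℍ* = ℍ ∪ P¹(ℚ)`. -/
inductive ExtHalfPlane : Type
  | point (z : ℍ) : ExtHalfPlane
  | cusp (c : OnePoint ℚ) : ExtHalfPlane

namespace ExtHalfPlane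

instance : MulAction SL(2, ℤ) ExtHalfPlane where
  smul g x := match x with
    | point z => point (g • z)
    | cusp c => cusp (moveCusp g c)
  one_smul x := by
    cases x with
    | point z => exact congrArg point (one_smul _ z)
    | cusp c =>
      refine congrArg cusp ?_
      simp [moveCusp]
  mul_smul g h x := by
    cases x with
    | point z => exact congrArg point (mul_smul g h z)
    | cusp c =>
      refine congrArg cusp ?_
      simp [moveCusp, mul_smul]

/-- The points of `ℍ` in the open horoball at the cusp `c` with parameter `T > 0`: the half-plane
`Im z > T` at `∞`, and the open Euclidean disc of radius `1 / (2 T)` tangent to the real axis at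
`r`, that is `Im z / |z - r|² > T`, at `r ∈ ℚ`. -/
def horoball (c : OnePoint ℚ) (T : ℝ) : Set ℍ :=
  c.elim {z | T < z.im} (fun r => {z | T < z.im / Complex.normSq ((z : ℂ) - (r : ℂ))})

lemma horoball_anti (c : OnePoint ℚ) {S T : ℝ} (h : S ≤ T) : horoball c T ⊆ horoball c S := by
  intro z hz
  cases c with
  | infty => exact lt_of_le_of_lt h hz
  | coe r => exact lt_of_le_of_lt h hz

/-- The horoball topology of `ℍ*`: it induces the usual topology on the open subset `ℍ`, and the
sets `{c} ∪ horoball c T` with `T > 0` are a basis of neighbourhoods of the cusp `c`. -/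
instance : TopologicalSpace ExtHalfPlane where
  IsOpen U := IsOpen {z : ℍ | point z ∈ U} ∧
    ∀ c : OnePoint ℚ, cusp c ∈ U → ∃ T : ℝ, 0 < T ∧ ∀ z ∈ horoball c T, point z ∈ U
  isOpen_univ := ⟨by simp, fun _ _ => ⟨1, one_pos, fun _ _ => trivial⟩⟩
  isOpen_inter U V hU hV := by
    refine ⟨hU.1.inter hV.1, fun c hc => ?_⟩
    obtain ⟨S, hS, hSU⟩ := hU.2 c hc.1
    obtain ⟨T, hT, hTV⟩ := hV.2 c hc.2
    exact ⟨max S T, lt_max_of_lt_left hS, fun z hz =>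
      ⟨hSU z (horoball_anti c (le_max_left S T) hz),
        hTV z (horoball_anti c (le_max_right S T) hz)⟩⟩
  isOpen_sUnion F hF := by
    refine ⟨?_, ?_⟩
    · have h : {z : ℍ | point z ∈ ⋃₀ F} = ⋃ U ∈ F, {z : ℍ | point z ∈ U} := by
        ext z
        simp
      rw [h]
      exact isOpen_biUnion fun U hU => (hF U hU).1
    · rintro c ⟨U, hU, hc⟩
      obtain ⟨T, hT, hTU⟩ := (hF U hU).2 c hc
      exact ⟨T, hT, fun z hz => ⟨U, hU, hTU z hz⟩⟩

/-- The reflection `σ(z) = - conj z` of `ℍ`, with `σ(r) = -r` and `σ(∞) = ∞` on `P¹(ℚ)`. -/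
def refl : ExtHalfPlane → ExtHalfPlane
  | point z => point ⟨-(starRingEnd ℂ) (z : ℂ), by simpa using z.im_pos⟩
  | cusp c => cusp (c.map (fun r => -r))

end ExtHalfPlane

open ExtHalfPlane

/-- The conjugate of `(a, b; c, d)` by the reflection `σ`, namely `(a, -b; -c, d)`. -/
def hat (g : SL(2, ℤ)) : SL(2, ℤ) :=
  ⟨!![g 0 0, -(g 0 1); -(g 1 0), g 1 1], by
    have h := g.det_coe
    rw [Matrix.det_fin_two] at h
    rw [Matrix.det_fin_two_of]
    linarith⟩

lemma refl_smul (g : SL(2, ℤ)) (x : ExtHalfPlane) : refl (g • x) = hat g • refl x := by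
  have h00 : (hat g) 0 0 = g 0 0 := rfl
  have h01 : (hat g) 0 1 = -(g 0 1) := rfl
  have h10 : (hat g) 1 0 = -(g 1 0) := rfl
  have h11 : (hat g) 1 1 = g 1 1 := rfl
  cases x with
  | point z =>
    refine congrArg point (UpperHalfPlane.ext ?_)
    change -(starRingEnd ℂ) ((g • z : ℍ) : ℂ) = _
    rw [UpperHalfPlane.coe_specialLinearGroup_apply, UpperHalfPlane.coe_specialLinearGroup_apply]
    simp [h00, h01, h10, h11, neg_div', neg_add_rev, add_comm]
  | cusp c =>
    refine congrArg cusp ?_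
    unfold moveCusp
    cases c with
    | infty =>
      rw [OnePoint.map_infty, OnePoint.smul_infty_eq_ite, OnePoint.smul_infty_eq_ite]
      by_cases h : g 1 0 = 0
      · simp [h10, h]
      · simp [h00, h10, h, div_neg]
    | coe r =>
      rw [OnePoint.map_some, OnePoint.smul_some_eq_ite, OnePoint.smul_some_eq_ite]
      by_cases h : (g 1 0 : ℚ) * r + g 1 1 = 0
      · simp [h10, h11, h]
      · simp [h00, h01, h10, h11, h]
        rw [← neg_div]
        congr 2
        ring

lemma hat_mem {N : ℕ} {g : SL(2, ℤ)} (hg : g ∈ CongruenceSubgroup.Gamma0 N) :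
    hat g ∈ CongruenceSubgroup.Gamma0 N := by
  rw [CongruenceSubgroup.Gamma0_mem] at hg ⊢
  simp [hat, hg]

/-- The modular curve `X₀(N) = Γ₀(N) \ ℍ*`, as a set of orbits. -/
def X0 (N : ℕ) : Type :=
  MulAction.orbitRel.Quotient (CongruenceSubgroup.Gamma0 N) ExtHalfPlane

/-- The projection `ℍ* → X₀(N)`. -/
def proj (N : ℕ) (x : ExtHalfPlane) : X0 N :=
  Quotient.mk (MulAction.orbitRel (CongruenceSubgroup.Gamma0 N) ExtHalfPlane) x

/-- `X₀(N)` carries the quotient topology. -/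
instance (N : ℕ) : TopologicalSpace (X0 N) := TopologicalSpace.coinduced (proj N) inferInstance

/-- The involution of `X₀(N)` induced by `σ`. -/
def sigma (N : ℕ) : X0 N → X0 N :=
  Quotient.map refl (by
    rintro x y ⟨g, hg⟩
    refine ⟨⟨hat (g : SL(2, ℤ)), hat_mem g.2⟩, ?_⟩
    have h : (g : SL(2, ℤ)) • y = x := hg
    exact (h ▸ refl_smul (g : SL(2, ℤ)) y).symm)

lemma sigma_proj (N : ℕ) (x : ExtHalfPlane) : sigma N (proj N x) = proj N (refl x) := rfl

/-- The set of points of `X₀(N)` fixed by `σ`. -/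
def fixSet (N : ℕ) : Set (X0 N) := {x | sigma N x = x}

/-- The set of cusps of `X₀(N)`. -/
def cusps (N : ℕ) : Set (X0 N) := Set.range fun c : OnePoint ℚ => proj N (cusp c)

/-- A simple closed curve in a topological space: a subset homeomorphic to the circle. -/
def IsSimpleClosedCurve {X : Type*} [TopologicalSpace X] (C : Set X) : Prop :=
  ∃ f : Circle → X, Topology.IsEmbedding f ∧ Set.range f = C

/-- The complete hyperbolic geodesic of `ℍ` with distinct endpoints `a, b ∈ P¹(ℚ)`: a vertical line
if one endpoint is `∞`, and the half-circle with diameter `[a, b]` otherwise. (It is empty for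
`a = b`.) -/
def geodesic (a b : OnePoint ℚ) : Set ℍ :=
  a.elim (b.elim ∅ fun s => {z | z.re = s})
    fun r => b.elim {z | z.re = r}
      fun s => {z | ‖(z : ℂ) - ((r : ℂ) + s) / 2‖ = |(r : ℝ) - s| / 2}

/-- The geodesic together with its two endpoints, as a subset of `ℍ*`. -/
def closedGeodesic (a b : OnePoint ℚ) : Set ExtHalfPlane :=
  point '' geodesic a b ∪ {cusp a, cusp b}

end ModCurve

end

/-! A point `π(z)` with `z` in `ℍ` is fixed by `σ` exactly when some `h = (a, b; c, d)` in `Γ₀(N)`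
satisfies `h(-conj z) = z`. This forces `a = d` and puts `z` on the geodesic `c|z|² - 2a Re z + b =
0`, whose discriminant `a² - bc = 1` is a square, so its endpoints are cusps. The problem is thus to
classify such `h`, up to sign, under `h ↦ g⁻¹ h (hat g)`, which is conjugation of the reflection `h
∘ σ` by `g`.

There are two invariants: `a` modulo `N`, and whether `h` is diagonal modulo 2. Since `a² ≡ 1`
modulo `pq`, after a change of sign `a ≡ 1` modulo `p` and `a ≡ ±1` modulo `q`; this sign selects
the curve and the parity selects one of its two geodesics. The invariants are complete: over `SL(2,
ℤ)` every `h` reduces to `1` or `T` (`exists_conj_T_zpow`), and for odd `N` the conjugating matrix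
lies in `Γ₀(N)` once the residues of `a` agree (`exists_conj`). So four explicit geodesics cover the
fixed points in `ℍ` (`exists_mem_geodesic_of_fixed`).

Conversely, for `N > 4` a point lies on the axis of only one reflection up to sign
(`eq_or_eq_neg_of_fixed`). Hence equivalent points on the four geodesics have conjugate reflections,
and by the invariants they lie on the same geodesic. Only `±1` commutes with a reflection, and no
element of `Γ₀(N)` reverses one of these axes, so the two points coincide (`eq_of_mem_geodesics`).

The class of a cusp `x / y` depends only on which of `p`, `q` divide `y`, so all cusps are fixed and
the two geodesics of a pair have equivalent ends. Glued there, they give a continuous injection of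
the circle into `X₀(N)`, which is an embedding because `X₀(N)` is Hausdorff. -/

noncomputable section

namespace ModCurve

open ExtHalfPlane

/-! ### Cusps as primitive integer vectors, and their classes modulo `Γ₀(pq)`. -/

section Cusps

/-- The cusp `x / y`, which is `∞` for `y = 0`. -/
def cuspOf (x y : ℤ) : OnePoint ℚ :=
  if y = 0 then OnePoint.infty else ((x / y : ℚ) : OnePoint ℚ)

lemma moveCusp_cuspOf (g : SL(2, ℤ)) {x y : ℤ} (h : x ≠ 0 ∨ y ≠ 0) :
    moveCusp g (cuspOf x y) = cuspOf (g 0 0 * x + g 0 1 * y) (g 1 0 * x + g 1 1 * y) := by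
  unfold moveCusp cuspOf
  by_cases hy : y = 0
  · subst hy
    have hx : x ≠ 0 := by simpa using h
    have hx' : (x : ℚ) ≠ 0 := by exact_mod_cast hx
    rw [if_pos rfl, OnePoint.smul_infty_eq_ite]
    by_cases hc : g 1 0 = 0
    · simp [hc]
    · simp [hc, hx]
      rw [mul_div_mul_right _ _ hx']
  · have hy' : (y : ℚ) ≠ 0 := by exact_mod_cast hy
    rw [if_neg hy, OnePoint.smul_some_eq_ite]
    have key : (g 1 0 : ℚ) * (x / y) + g 1 1 = ((g 1 0 * x + g 1 1 * y : ℤ) : ℚ) / y := by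
      push_cast
      field_simp
    have key2 : (g 0 0 : ℚ) * (x / y) + g 0 1 = ((g 0 0 * x + g 0 1 * y : ℤ) : ℚ) / y := by
      push_cast
      field_simp
    have e00 : (Matrix.SpecialLinearGroup.mapGL ℚ g) 0 0 = (g 0 0 : ℚ) := by simp
    have e01 : (Matrix.SpecialLinearGroup.mapGL ℚ g) 0 1 = (g 0 1 : ℚ) := by simp
    have e10 : (Matrix.SpecialLinearGroup.mapGL ℚ g) 1 0 = (g 1 0 : ℚ) := by simp
    have e11 : (Matrix.SpecialLinearGroup.mapGL ℚ g) 1 1 = (g 1 1 : ℚ) := by simp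
    rw [e00, e01, e10, e11, key, key2, div_div_div_cancel_right₀ hy']
    by_cases hc : g 1 0 * x + g 1 1 * y = 0
    · simp [hc]
    · have hc' : ((g 1 0 * x + g 1 1 * y : ℤ) : ℚ) / y ≠ 0 :=
        div_ne_zero (by exact_mod_cast hc) hy'
      rw [if_neg hc', if_neg hc]

lemma exists_cuspOf (c : OnePoint ℚ) : ∃ x y : ℤ, IsCoprime x y ∧ c = cuspOf x y := by
  cases c with
  | infty => exact ⟨1, 0, isCoprime_one_left, by simp [cuspOf]⟩
  | coe r =>
    refine ⟨r.num, r.den, ?_, ?_⟩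
    · rw [Int.isCoprime_iff_gcd_eq_one]
      simpa [Int.gcd] using r.reduced
    · have : (r.den : ℤ) ≠ 0 := by exact_mod_cast r.den_ne_zero
      simp [cuspOf, Rat.num_div_den]

lemma cuspOf_eq_iff {x y x' y' : ℤ} (h : x ≠ 0 ∨ y ≠ 0) (h' : x' ≠ 0 ∨ y' ≠ 0) :
    cuspOf x y = cuspOf x' y' ↔ x * y' = x' * y := by
  unfold cuspOf
  by_cases hy : y = 0 <;> by_cases hy' : y' = 0
  · simp [hy, hy']
  · simp_all
  · simp_all
  · have h1 : (y : ℚ) ≠ 0 := by exact_mod_cast hy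
    have h2 : (y' : ℚ) ≠ 0 := by exact_mod_cast hy'
    rw [if_neg hy, if_neg hy', OnePoint.coe_eq_coe, div_eq_div_iff h1 h2]
    norm_cast

lemma ne_zero_or_of_isCoprime {x y : ℤ} (h : IsCoprime x y) : x ≠ 0 ∨ y ≠ 0 := by
  by_contra! hc
  rw [hc.1, hc.2] at h
  exact not_isCoprime_zero_zero h

/-- A primitive vector is determined by its cusp up to sign. -/
lemma dvd_iff_of_cuspOf_eq {x y x' y' : ℤ} (h : IsCoprime x y) (h' : IsCoprime x' y')
    (he : cuspOf x y = cuspOf x' y') (d : ℤ) : d ∣ y ↔ d ∣ y' := by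
  rw [cuspOf_eq_iff (ne_zero_or_of_isCoprime h) (ne_zero_or_of_isCoprime h')] at he
  have h1 : y ∣ y' := h.symm.dvd_of_dvd_mul_left (he ▸ Dvd.intro_left _ rfl)
  have h2 : y' ∣ y := h'.symm.dvd_of_dvd_mul_left (he ▸ Dvd.intro_left _ rfl)
  exact ⟨fun h => h.trans h1, fun h => h.trans h2⟩

lemma det_eq_one (g : SL(2, ℤ)) : g 0 0 * g 1 1 - g 0 1 * g 1 0 = 1 := by
  have h := g.det_coe
  rwa [Matrix.det_fin_two] at h

lemma isCoprime_smul (g : SL(2, ℤ)) {x y : ℤ} (h : IsCoprime x y) :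
    IsCoprime (g 0 0 * x + g 0 1 * y) (g 1 0 * x + g 1 1 * y) := by
  obtain ⟨a, b, hab⟩ := h
  refine ⟨a * g 1 1 - b * g 1 0, b * g 0 0 - a * g 0 1, ?_⟩
  linear_combination (a * x + b * y) * det_eq_one g + hab

lemma refl_cuspOf (x y : ℤ) : refl (cusp (cuspOf x y)) = cusp (cuspOf (-x) y) := by
  unfold cuspOf
  by_cases hy : y = 0
  · simp [hy, ExtHalfPlane.refl]
  · simp [hy, ExtHalfPlane.refl, neg_div]

lemma proj_eq_iff {N : ℕ} {a b : ExtHalfPlane} :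
    proj N a = proj N b ↔ ∃ g ∈ CongruenceSubgroup.Gamma0 N, g • b = a := by
  refine (Quotient.eq (r := MulAction.orbitRel (CongruenceSubgroup.Gamma0 N) ExtHalfPlane)).trans ?_
  constructor
  · rintro ⟨g, hg⟩
    exact ⟨g.1, g.2, hg⟩
  · rintro ⟨g, hg, h⟩
    exact ⟨⟨g, hg⟩, h⟩

lemma smul_cusp (g : SL(2, ℤ)) (c : OnePoint ℚ) : g • cusp c = cusp (moveCusp g c) := rfl

lemma smul_point (g : SL(2, ℤ)) (z : ℍ) : g • point z = point (g • z) := rfl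

lemma proj_point_eq_iff {N : ℕ} {z w : ℍ} :
    proj N (point z) = proj N (point w) ↔ ∃ g ∈ CongruenceSubgroup.Gamma0 N, g • w = z := by
  simp [proj_eq_iff, smul_point]

lemma proj_cusp_eq_iff {N : ℕ} {a b : OnePoint ℚ} :
    proj N (cusp a) = proj N (cusp b) ↔
      ∃ g ∈ CongruenceSubgroup.Gamma0 N, moveCusp g b = a := by
  simp [proj_eq_iff, smul_cusp]

lemma proj_cusp_ne_point {N : ℕ} (c : OnePoint ℚ) (z : ℍ) :
    proj N (cusp c) ≠ proj N (point z) := by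
  simp [Ne, proj_eq_iff, smul_point]

lemma Gamma0_dvd {N : ℕ} {g : SL(2, ℤ)} : g ∈ CongruenceSubgroup.Gamma0 N ↔ (N : ℤ) ∣ g 1 0 := by
  rw [CongruenceSubgroup.Gamma0_mem, ZMod.intCast_zmod_eq_zero_iff_dvd]

/-- Modulo `d` the matrix `g` is upper triangular with unit diagonal entries, so it multiplies the
denominator by a unit. -/
lemma dvd_iff_of_proj_eq {N : ℕ} {x y x' y' : ℤ} (h : IsCoprime x y) (h' : IsCoprime x' y')
    (he : proj N (cusp (cuspOf x y)) = proj N (cusp (cuspOf x' y'))) {d : ℤ} (hd : d ∣ N) :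
    d ∣ y ↔ d ∣ y' := by
  obtain ⟨g, hg, hgx⟩ := proj_cusp_eq_iff.1 he
  rw [moveCusp_cuspOf g (ne_zero_or_of_isCoprime h')] at hgx
  rw [← dvd_iff_of_cuspOf_eq (isCoprime_smul g h') h hgx]
  have hc : d ∣ g 1 0 := hd.trans (Gamma0_dvd.1 hg)
  rw [dvd_add_right (hc.mul_right _)]
  refine ⟨fun hdv => ?_, fun hdv => hdv.mul_left _⟩
  have hcop : IsCoprime d (g 1 1) := by
    obtain ⟨k, hk⟩ := hc
    refine ⟨-(g 0 1 * k), g 0 0, ?_⟩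
    linear_combination det_eq_one g + g 0 1 * hk
  exact hcop.dvd_of_dvd_mul_left hdv

/-- A primitive vector is the first column of a matrix of determinant one. -/
lemma exists_SL_col {x y : ℤ} (h : IsCoprime x y) : ∃ g : SL(2, ℤ), g 0 0 = x ∧ g 1 0 = y := by
  obtain ⟨a, b, hab⟩ := h
  refine ⟨⟨!![x, -b; y, a], ?_⟩, rfl, rfl⟩
  rw [Matrix.det_fin_two_of]
  linear_combination hab

/-- Either both sides of the congruence vanish modulo `p`, or `y * y'` is invertible and `m` can be
solved for. -/
lemma exists_dvd_sub_mul {p : ℤ} (hp : Prime p) {y y' t t' : ℤ} (h : p ∣ y ↔ p ∣ y') :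
    ∃ m : ℤ, p ∣ (y' * t - y * t') - m * (y * y') := by
  by_cases hy : p ∣ y
  · exact ⟨0, by simpa using dvd_sub ((h.1 hy).mul_right t) (hy.mul_right t')⟩
  · have hy' : ¬ p ∣ y' := fun h' => hy (h.2 h')
    have hyy : ¬ p ∣ y * y' := fun h' => (hp.dvd_or_dvd h').elim hy hy'
    obtain ⟨a, b, hab⟩ := (hp.coprime_iff_not_dvd).2 hyy
    exact ⟨b * (y' * t - y * t'), ⟨a * (y' * t - y * t'), by
      linear_combination (y' * t - y * t') * (-hab)⟩⟩

/-- For distinct primes `p` and `q`, the class of a cusp modulo `Γ₀(pq)` depends only on which of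
`p`, `q` divide the denominator. -/
lemma exists_moveCusp_eq {p q : ℕ} (hp : p.Prime) (hq : q.Prime) (hpq : p ≠ q) {x y x' y' : ℤ}
    (h : IsCoprime x y) (h' : IsCoprime x' y') (h1 : (p : ℤ) ∣ y ↔ (p : ℤ) ∣ y')
    (h2 : (q : ℤ) ∣ y ↔ (q : ℤ) ∣ y') :
    ∃ g ∈ CongruenceSubgroup.Gamma0 (p * q), moveCusp g (cuspOf x y) = cuspOf x' y' := by
  obtain ⟨g, rfl, rfl⟩ := exists_SL_col h
  obtain ⟨k, rfl, rfl⟩ := exists_SL_col h'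
  obtain ⟨m, hm⟩ := exists_dvd_sub_mul (Nat.prime_iff_prime_int.1 hp) (t := g 1 1) (t' := k 1 1) h1
  obtain ⟨n, hn⟩ := exists_dvd_sub_mul (Nat.prime_iff_prime_int.1 hq) (t := g 1 1) (t' := k 1 1) h2
  have hcop : IsCoprime (p : ℤ) (q : ℤ) :=
    Nat.isCoprime_iff_coprime.2 ((Nat.coprime_primes hp hq).2 hpq)
  obtain ⟨r, s, hrs⟩ := id hcop
  have hT : (ModularGroup.T ^ (m * s * q + n * r * p) : SL(2, ℤ)).1 =
      !![1, m * s * q + n * r * p; 0, 1] := ModularGroup.coe_T_zpow _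
  set l := m * s * q + n * r * p with hl
  -- Every power `l` gives a matrix carrying one cusp to the other. The Chinese remainder choice `l
  -- ≡ m` modulo `p`, `l ≡ n` modulo `q` makes its lower left entry divisible by both primes.
  refine ⟨k * ModularGroup.T ^ l * g⁻¹, ?_, ?_⟩
  · rw [Gamma0_dvd]
    have he : (k * ModularGroup.T ^ l * g⁻¹) 1 0 =
        (k 1 0 * g 1 1 - g 1 0 * k 1 1) - l * (g 1 0 * k 1 0) := by
      simp [hT, Matrix.mul_apply, Fin.sum_univ_two, Matrix.SpecialLinearGroup.coe_inv,
        Matrix.adjugate_fin_two]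
      ring
    rw [he]
    push_cast
    refine hcop.mul_dvd ?_ ?_
    · convert dvd_add hm (Dvd.intro ((m - n) * r * (g 1 0 * k 1 0)) rfl) using 1
      linear_combination (- m * (g 1 0 * k 1 0)) * hrs + (- (g 1 0 * k 1 0)) * hl
    · convert dvd_add hn (Dvd.intro ((n - m) * s * (g 1 0 * k 1 0)) rfl) using 1
      linear_combination (- n * (g 1 0 * k 1 0)) * hrs + (- (g 1 0 * k 1 0)) * hl
  · rw [moveCusp_cuspOf _ (ne_zero_or_of_isCoprime h)]
    have hd := det_eq_one g
    have e0 : (k * ModularGroup.T ^ l * g⁻¹) 0 0 * g 0 0 +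
        (k * ModularGroup.T ^ l * g⁻¹) 0 1 * g 1 0 = k 0 0 := by
      simp [hT, Matrix.mul_apply, Fin.sum_univ_two, Matrix.SpecialLinearGroup.coe_inv,
        Matrix.adjugate_fin_two]
      linear_combination k 0 0 * hd
    have e1 : (k * ModularGroup.T ^ l * g⁻¹) 1 0 * g 0 0 +
        (k * ModularGroup.T ^ l * g⁻¹) 1 1 * g 1 0 = k 1 0 := by
      simp [hT, Matrix.mul_apply, Fin.sum_univ_two, Matrix.SpecialLinearGroup.coe_inv,
        Matrix.adjugate_fin_two]
      linear_combination k 1 0 * hd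
    rw [e0, e1]

end Cusps

/-! ### Heights at cusps and their equivariance. -/

section Height

lemma smul_ne_zero_or (g : SL(2, ℤ)) {x y : ℤ} (h : x ≠ 0 ∨ y ≠ 0) :
    g 0 0 * x + g 0 1 * y ≠ 0 ∨ g 1 0 * x + g 1 1 * y ≠ 0 := by
  by_contra! h0
  have hd := det_eq_one g
  have hx : x = 0 := by linear_combination g 1 1 * h0.1 - g 0 1 * h0.2 - x * hd
  have hy : y = 0 := by linear_combination g 0 0 * h0.2 - g 1 0 * h0.1 - y * hd
  simp [hx, hy] at h

/-- The height of `z` at the cusp `x / y`, invariant under the simultaneous action of `SL(2, ℤ)`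
on the vector `(x, y)` and the point `z`. -/
def height (x y : ℤ) (z : ℍ) : ℝ := z.im / Complex.normSq ((y : ℂ) * z - x)

lemma normSq_mul_sub (x y : ℝ) (z : ℍ) :
    Complex.normSq ((y : ℂ) * z - x) = (y * z.re - x) ^ 2 + (y * z.im) ^ 2 := by
  simp [Complex.normSq_apply]
  ring

lemma normSq_mul_sub_pos {x y : ℝ} (h : x ≠ 0 ∨ y ≠ 0) (z : ℍ) :
    0 < Complex.normSq ((y : ℂ) * z - x) := by
  rw [normSq_mul_sub]
  by_cases hy : y = 0
  · subst hy
    have hx : x ≠ 0 := by simpa using h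
    have := sq_pos_of_ne_zero hx
    simpa using this
  · have := sq_pos_of_ne_zero (mul_ne_zero hy z.im_ne_zero)
    positivity

lemma height_eq (x y : ℤ) (z : ℍ) :
    height x y z = z.im / ((y * z.re - x) ^ 2 + (y * z.im) ^ 2) := by
  rw [height, ← normSq_mul_sub]
  simp

lemma cast_ne_zero_or {x y : ℤ} (h : x ≠ 0 ∨ y ≠ 0) : (x : ℝ) ≠ 0 ∨ (y : ℝ) ≠ 0 :=
  h.imp (fun h => by exact_mod_cast h) (fun h => by exact_mod_cast h)

lemma height_denom_pos {x y : ℤ} (h : x ≠ 0 ∨ y ≠ 0) (z : ℍ) :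
    0 < ((y : ℝ) * z.re - x) ^ 2 + (y * z.im) ^ 2 := by
  rw [← normSq_mul_sub]
  exact normSq_mul_sub_pos (cast_ne_zero_or h) z

lemma coe_smul_eq (g : SL(2, ℤ)) (z : ℍ) :
    ((g • z : ℍ) : ℂ) = ((g 0 0 : ℂ) * z + g 0 1) / ((g 1 0 : ℂ) * z + g 1 1) := by
  rw [UpperHalfPlane.coe_specialLinearGroup_apply]
  simp

lemma denom_ne_zero (g : SL(2, ℤ)) (z : ℍ) : (g 1 0 : ℂ) * z + g 1 1 ≠ 0 := by
  have h : ((-(g 1 1) : ℤ) : ℝ) ≠ 0 ∨ ((g 1 0 : ℤ) : ℝ) ≠ 0 := by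
    refine cast_ne_zero_or ?_
    by_contra! hc
    have := det_eq_one g
    rw [hc.2, neg_eq_zero.1 hc.1] at this
    simp at this
  have := normSq_mul_sub_pos h z
  rw [Complex.normSq_pos] at this
  simpa using this

lemma im_smul_eq (g : SL(2, ℤ)) (z : ℍ) :
    (g • z).im = z.im / Complex.normSq ((g 1 0 : ℂ) * z + g 1 1) := by
  rw [← UpperHalfPlane.coe_im, coe_smul_eq, Complex.div_im]
  have hd : ((g 0 0 : ℝ) * g 1 1 - g 0 1 * g 1 0) = 1 := by exact_mod_cast det_eq_one g
  rw [← sub_div]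
  congr 1
  simp
  linear_combination z.im * hd

lemma height_smul (g : SL(2, ℤ)) (x y : ℤ) (z : ℍ) :
    height (g 0 0 * x + g 0 1 * y) (g 1 0 * x + g 1 1 * y) (g • z) = height x y z := by
  have hz := denom_ne_zero g z
  have hd : ((g 0 0 : ℂ) * g 1 1 - g 0 1 * g 1 0) = 1 := by exact_mod_cast det_eq_one g
  have key : ((g 1 0 * x + g 1 1 * y : ℤ) : ℂ) * (g • z : ℍ) - (g 0 0 * x + g 0 1 * y : ℤ) =
      (y * z - x) / ((g 1 0 : ℂ) * z + g 1 1) := by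
    rw [coe_smul_eq]
    push_cast
    field_simp
    linear_combination ((y : ℂ) * z - x) * hd
  unfold height
  rw [key, im_smul_eq, map_div₀, div_div_div_cancel_right₀]
  exact (Complex.normSq_pos.2 hz).ne'

lemma height_inv_smul (g : SL(2, ℤ)) (x y : ℤ) (z : ℍ) :
    height (g 0 0 * x + g 0 1 * y) (g 1 0 * x + g 1 1 * y) z = height x y (g⁻¹ • z) := by
  have h := height_smul g x y (g⁻¹ • z)
  rwa [smul_inv_smul] at h

lemma continuous_height {x y : ℤ} (h : x ≠ 0 ∨ y ≠ 0) : Continuous (height x y) := by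
  have : height x y = fun z : ℍ => z.im / ((y * z.re - x) ^ 2 + (y * z.im) ^ 2) :=
    funext (height_eq x y)
  rw [this]
  refine Continuous.div UpperHalfPlane.continuous_im ?_ fun z => (height_denom_pos h z).ne'
  have h1 := UpperHalfPlane.continuous_im
  have h2 := UpperHalfPlane.continuous_re
  fun_prop

lemma one_le_sq_cast {y : ℤ} (hy : y ≠ 0) : (1 : ℝ) ≤ (y : ℝ) ^ 2 := by
  have : (1 : ℤ) ≤ y ^ 2 := by
    have := sq_pos_of_ne_zero hy
    omega
  exact_mod_cast this

/-- The bound does not depend on `x` and `y`, so it controls the height of `z` at a whole orbit of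
cusps at once. -/
lemma height_le {x y : ℤ} (h : x ≠ 0 ∨ y ≠ 0) (z : ℍ) : height x y z ≤ max z.im (1 / z.im) := by
  have hz := z.im_pos
  rw [height_eq, div_le_iff₀ (height_denom_pos h z)]
  by_cases hy : y = 0
  · subst hy
    have hx : x ≠ 0 := by simpa using h
    have h1 := one_le_sq_cast hx
    calc z.im ≤ z.im * x ^ 2 := le_mul_of_one_le_right hz.le h1
      _ ≤ max z.im (1 / z.im) * x ^ 2 := by gcongr; exact le_max_left _ _
      _ = _ := by simp
  · have h1 := one_le_sq_cast hy
    calc z.im = 1 / z.im * z.im ^ 2 := by field_simp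
      _ ≤ 1 / z.im * ((y * z.re - x) ^ 2 + (y * z.im) ^ 2) := by
        gcongr
        nlinarith [sq_nonneg (y * z.re - x), sq_nonneg z.im]
      _ ≤ _ := by gcongr; exact le_max_right _ _

/-- Horoballs of height greater than one at different cusps are disjoint. -/
lemma eq_of_one_lt_height {x y x' y' : ℤ} (h : x ≠ 0 ∨ y ≠ 0) (h' : x' ≠ 0 ∨ y' ≠ 0) {z : ℍ}
    (h1 : 1 < height x y z) (h2 : 1 < height x' y' z) : x * y' = x' * y := by
  rw [height_eq, one_lt_div (height_denom_pos h z)] at h1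
  rw [height_eq, one_lt_div (height_denom_pos h' z)] at h2
  have hz := z.im_pos
  by_contra hne
  have hd := one_le_sq_cast (sub_ne_zero.2 hne)
  push_cast at hd
  set u := (y : ℝ) * z.re - x with hu
  set v := (y' : ℝ) * z.re - x' with hv
  -- The determinant times `Im z` is the cross product of two plane vectors of squared length less
  -- than `Im z`, so a nonzero integer determinant is impossible.
  have hid : ((x : ℝ) * y' - x' * y) * z.im = v * (y * z.im) - u * (y' * z.im) := by
    rw [hu, hv]
    ring
  have hcs : (v * (y * z.im) - u * (y' * z.im)) ^ 2 ≤
      (u ^ 2 + (y * z.im) ^ 2) * (v ^ 2 + (y' * z.im) ^ 2) := by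
    nlinarith [sq_nonneg (u * v + (y * z.im) * (y' * z.im))]
  have hlt : (u ^ 2 + (y * z.im) ^ 2) * (v ^ 2 + (y' * z.im) ^ 2) < z.im * z.im :=
    mul_lt_mul'' h1 h2 (by positivity) (by positivity)
  rw [← hid, mul_pow] at hcs
  nlinarith [mul_le_mul_of_nonneg_right hd (sq_nonneg z.im)]

/-- The horoball parameter and the height differ by the factor `y²` (or `x²` at `∞`), so either one
describes the topology at the cusp. -/
lemma exists_horoball_iff {x y : ℤ} (h : x ≠ 0 ∨ y ≠ 0) :
    ∃ K : ℝ, 0 < K ∧ ∀ T z, z ∈ horoball (cuspOf x y) T ↔ T < K * height x y z := by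
  by_cases hy : y = 0
  · subst hy
    have hx : x ≠ 0 := by simpa using h
    have h1 := one_le_sq_cast hx
    refine ⟨x ^ 2, by linarith, fun T z => ?_⟩
    have : (x : ℝ) ^ 2 * height x 0 z = z.im := by
      rw [height_eq]
      have hx' : (x : ℝ) ≠ 0 := by exact_mod_cast hx
      simp
      field_simp
    rw [this]
    simp [cuspOf, horoball]
  · have h1 := one_le_sq_cast hy
    have hy' : (y : ℂ) ≠ 0 := by exact_mod_cast hy
    refine ⟨y ^ 2, by linarith, fun T z => ?_⟩
    have : (z : ℂ) - ((x / y : ℚ) : ℂ) = (y * z - x) / y := by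
      push_cast
      field_simp
    have hn : Complex.normSq (y : ℂ) = (y : ℝ) ^ 2 := by
      rw [Complex.normSq_intCast, sq]
    simp only [cuspOf, horoball, hy, if_false, OnePoint.elim_some, Set.mem_ofPred_eq, this,
      map_div₀, hn, height]
    rw [div_div_eq_mul_div, mul_comm, mul_div_assoc]

end Height

/-! ### The quotient topology and the Hausdorff property of `X₀(N)`. -/

section Topology

lemma isOpen_iff {U : Set ExtHalfPlane} : IsOpen U ↔ IsOpen {z : ℍ | point z ∈ U} ∧
    ∀ c : OnePoint ℚ, cusp c ∈ U → ∃ T : ℝ, 0 < T ∧ ∀ z ∈ horoball c T, point z ∈ U :=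
  Iff.rfl

lemma isOpen_iff_height {U : Set ExtHalfPlane} : IsOpen U ↔ IsOpen {z : ℍ | point z ∈ U} ∧
    ∀ x y : ℤ, (x ≠ 0 ∨ y ≠ 0) → cusp (cuspOf x y) ∈ U →
      ∃ T : ℝ, 0 < T ∧ ∀ z, T < height x y z → point z ∈ U := by
  rw [isOpen_iff]
  refine and_congr_right fun _ => ⟨fun h x y hxy hc => ?_, fun h c hc => ?_⟩
  · obtain ⟨T, hT, hU⟩ := h _ hc
    obtain ⟨K, hK, hKT⟩ := exists_horoball_iff hxy
    refine ⟨T / K, div_pos hT hK, fun z hz => hU z ((hKT T z).2 ?_)⟩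
    rwa [div_lt_iff₀' hK] at hz
  · obtain ⟨x, y, hxy, rfl⟩ := exists_cuspOf c
    have hxy' := ne_zero_or_of_isCoprime hxy
    obtain ⟨T, hT, hU⟩ := h x y hxy' hc
    obtain ⟨K, hK, hKT⟩ := exists_horoball_iff hxy'
    refine ⟨K * T, mul_pos hK hT, fun z hz => hU z ?_⟩
    exact lt_of_mul_lt_mul_left ((hKT _ z).1 hz) hK.le

lemma isOpenMap_point : IsOpenMap point := fun U hU => by
  refine isOpen_iff.2 ⟨by simpa using hU, fun c hc => ?_⟩
  simp at hc

lemma smul_isometry (g : SL(2, ℤ)) : Isometry fun z : ℍ => g • z :=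
  isometry_smul ℍ (Matrix.SpecialLinearGroup.map (algebraMap ℤ ℝ) g : SL(2, ℝ))

lemma continuous_smul_ext (g : SL(2, ℤ)) : Continuous fun x : ExtHalfPlane => g • x := by
  refine ⟨fun U hU => ?_⟩
  rw [isOpen_iff_height] at hU ⊢
  refine ⟨hU.1.preimage (smul_isometry g).continuous, fun x y hxy hc => ?_⟩
  rw [Set.mem_preimage, smul_cusp, moveCusp_cuspOf g hxy] at hc
  obtain ⟨T, hT, h⟩ := hU.2 _ _ (smul_ne_zero_or g hxy) hc
  exact ⟨T, hT, fun z hz => h (g • z) (by rwa [height_smul])⟩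

lemma continuous_proj (N : ℕ) : Continuous (proj N) := continuous_coinduced_rng

lemma isOpenMap_proj (N : ℕ) : IsOpenMap (proj N) := by
  intro U hU
  refine isOpen_coinduced.2 ?_
  have : proj N ⁻¹' (proj N '' U) =
      ⋃ g ∈ CongruenceSubgroup.Gamma0 N, (fun x : ExtHalfPlane => g • x) ⁻¹' U := by
    ext a
    simp only [Set.mem_preimage, Set.mem_image, Set.mem_iUnion, proj_eq_iff]
    constructor
    · rintro ⟨b, hb, g, hg, rfl⟩
      exact ⟨g, hg, hb⟩
    · rintro ⟨g, hg, hb⟩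
      exact ⟨_, hb, g, hg, rfl⟩
  rw [this]
  exact isOpen_biUnion fun g _ => hU.preimage (continuous_smul_ext g)

/-- The open neighbourhood of the cusp `x / y` consisting of the points of large height. -/
def cuspNhd (x y : ℤ) (T : ℝ) : Set ExtHalfPlane :=
  {cusp (cuspOf x y)} ∪ point '' {z | T < height x y z}

lemma isOpen_cuspNhd {x y : ℤ} (h : x ≠ 0 ∨ y ≠ 0) (T : ℝ) : IsOpen (cuspNhd x y T) := by
  rw [isOpen_iff]
  constructor
  · simpa [cuspNhd] using isOpen_lt continuous_const (continuous_height h)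
  · intro c hc
    have hc' : c = cuspOf x y := by simpa [cuspNhd] using hc
    subst hc'
    obtain ⟨K, hK, hKT⟩ := exists_horoball_iff h
    -- `T` may be nonpositive, whereas the parameter of a horoball must be positive.
    refine ⟨K * max T 1, by positivity, fun z hz => Or.inr ⟨z, ?_, rfl⟩⟩
    have := lt_of_mul_lt_mul_left ((hKT _ z).1 hz) hK.le
    exact (le_max_left _ _).trans_lt this

lemma cusp_mem_cuspNhd (x y : ℤ) (T : ℝ) : cusp (cuspOf x y) ∈ cuspNhd x y T := Or.inl rfl

/-- The orbit of a point meets a bounded set in a finite set. -/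
lemma finite_orbit_inter_closedBall (w z : ℍ) (r : ℝ) :
    {v | (∃ g : SL(2, ℤ), g • w = v) ∧ v ∈ Metric.closedBall z r}.Finite := by
  have hf := ProperlyDiscontinuousSMul.finite_disjoint_inter_image
    (Γ := (Matrix.SpecialLinearGroup.mapGL ℝ : SL(2, ℤ) →* GL (Fin 2) ℝ).range)
    (K := {w}) (L := Metric.closedBall z r) isCompact_singleton (isCompact_closedBall z r)
  refine (hf.image fun γ => γ • w).subset ?_
  rintro _ ⟨⟨g, rfl⟩, hv⟩
  refine ⟨⟨Matrix.SpecialLinearGroup.mapGL ℝ g, ⟨g, rfl⟩⟩, ?_, rfl⟩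
  exact ⟨g • w, ⟨w, rfl, rfl⟩, hv⟩

/-- Only finitely many orbit points lie within distance one of `z`, and none of them is `z`. -/
lemma exists_pos_dist_smul {Γ : Subgroup SL(2, ℤ)} {z w : ℍ} (h : ∀ g ∈ Γ, g • w ≠ z) :
    ∃ ε : ℝ, 0 < ε ∧ ∀ g ∈ Γ, ε ≤ dist (g • w) z := by
  have hf := finite_orbit_inter_closedBall w z 1
  set E := {v | (∃ g ∈ Γ, g • w = v) ∧ v ∈ Metric.closedBall z 1} with hE
  have hfE : E.Finite := hf.subset fun v hv => ⟨⟨hv.1.choose, hv.1.choose_spec.2⟩, hv.2⟩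
  have hzE : z ∈ Eᶜ := fun hz => by
    obtain ⟨g, hg, hgz⟩ := hz.1
    exact h g hg hgz
  obtain ⟨ε, hε, hball⟩ := Metric.isOpen_iff.1 hfE.isClosed.isOpen_compl z hzE
  refine ⟨min ε 1, lt_min hε one_pos, fun g hg => ?_⟩
  by_contra! hlt
  obtain ⟨h1, h2⟩ := lt_min_iff.1 hlt
  exact hball (Metric.mem_ball.2 h1) ⟨⟨g, hg, rfl⟩, Metric.mem_closedBall.2 h2.le⟩

lemma height_proj_le {N : ℕ} {x y : ℤ} (h : x ≠ 0 ∨ y ≠ 0) {T : ℝ} {z : ℍ}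
    (hz : max z.im (1 / z.im) < T) : proj N (point z) ∉ proj N '' cuspNhd x y T := by
  rintro ⟨a, ha, hproj⟩
  rcases ha with rfl | ⟨w, hw, rfl⟩
  · exact proj_cusp_ne_point _ _ hproj
  · obtain ⟨g, -, rfl⟩ := proj_point_eq_iff.1 hproj
    have h1 := height_le (x := g⁻¹ 0 0 * x + g⁻¹ 0 1 * y) (y := g⁻¹ 1 0 * x + g⁻¹ 1 1 * y)
      (smul_ne_zero_or g⁻¹ h) z
    rw [height_inv_smul, inv_inv] at h1
    exact absurd (hw.trans_le h1) hz.not_gt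

lemma exists_separate_cusp_point (N : ℕ) {x y : ℤ} (h : x ≠ 0 ∨ y ≠ 0) (z : ℍ) :
    ∃ U V : Set (X0 N), IsOpen U ∧ IsOpen V ∧ proj N (cusp (cuspOf x y)) ∈ U ∧
      proj N (point z) ∈ V ∧ Disjoint U V := by
  set T := max z.im (1 / z.im) + 1
  have hc : Continuous fun w : ℍ => max w.im (1 / w.im) :=
    UpperHalfPlane.continuous_im.max
      (continuous_const.div UpperHalfPlane.continuous_im fun w => w.im_ne_zero)
  refine ⟨proj N '' cuspNhd x y T, proj N '' (point '' {w | max w.im (1 / w.im) < T}),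
    isOpenMap_proj N _ (isOpen_cuspNhd h T),
    isOpenMap_proj N _ (isOpenMap_point _ (isOpen_lt hc continuous_const)),
    ⟨_, cusp_mem_cuspNhd x y T, rfl⟩, ⟨_, ⟨z, lt_add_one (max z.im (1 / z.im)), rfl⟩, rfl⟩, ?_⟩
  rw [Set.disjoint_right]
  rintro _ ⟨_, ⟨w, hw, rfl⟩, rfl⟩
  exact height_proj_le h hw

lemma exists_separate_points (N : ℕ) {z w : ℍ} (h : proj N (point z) ≠ proj N (point w)) :
    ∃ U V : Set (X0 N), IsOpen U ∧ IsOpen V ∧ proj N (point z) ∈ U ∧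
      proj N (point w) ∈ V ∧ Disjoint U V := by
  obtain ⟨ε, hε, hd⟩ := exists_pos_dist_smul (Γ := CongruenceSubgroup.Gamma0 N) (z := z) (w := w)
    fun g hg hgw => h (proj_point_eq_iff.2 ⟨g, hg, hgw⟩)
  refine ⟨proj N '' (point '' Metric.ball z (ε / 2)), proj N '' (point '' Metric.ball w (ε / 2)),
    isOpenMap_proj N _ (isOpenMap_point _ Metric.isOpen_ball),
    isOpenMap_proj N _ (isOpenMap_point _ Metric.isOpen_ball),
    ⟨_, ⟨z, Metric.mem_ball_self (half_pos hε), rfl⟩, rfl⟩,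
    ⟨_, ⟨w, Metric.mem_ball_self (half_pos hε), rfl⟩, rfl⟩, ?_⟩
  rw [Set.disjoint_left]
  rintro _ ⟨_, ⟨u, hu, rfl⟩, rfl⟩ ⟨_, ⟨v, hv, rfl⟩, huv⟩
  obtain ⟨g, hg, rfl⟩ := proj_point_eq_iff.1 huv.symm
  have h1 : dist (g • w) (g • v) < ε / 2 := by
    rw [(smul_isometry g).dist_eq, dist_comm]
    exact hv
  have h2 := dist_triangle (g • w) (g • v) z
  have h3 : dist (g • v) z < ε / 2 := hu
  linarith [hd g hg]

lemma exists_separate_cusps (N : ℕ) {x y x' y' : ℤ} (h : IsCoprime x y) (h' : IsCoprime x' y')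
    (hne : proj N (cusp (cuspOf x y)) ≠ proj N (cusp (cuspOf x' y'))) :
    ∃ U V : Set (X0 N), IsOpen U ∧ IsOpen V ∧ proj N (cusp (cuspOf x y)) ∈ U ∧
      proj N (cusp (cuspOf x' y')) ∈ V ∧ Disjoint U V := by
  have h0 := ne_zero_or_of_isCoprime h
  have h0' := ne_zero_or_of_isCoprime h'
  refine ⟨proj N '' cuspNhd x y 1, proj N '' cuspNhd x' y' 1,
    isOpenMap_proj N _ (isOpen_cuspNhd h0 1), isOpenMap_proj N _ (isOpen_cuspNhd h0' 1),
    ⟨_, cusp_mem_cuspNhd x y 1, rfl⟩, ⟨_, cusp_mem_cuspNhd x' y' 1, rfl⟩, ?_⟩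
  rw [Set.disjoint_left]
  rintro _ ⟨_, rfl | ⟨u, hu, rfl⟩, rfl⟩ ⟨_, rfl | ⟨v, hv, rfl⟩, huv⟩
  · exact hne huv.symm
  · exact proj_cusp_ne_point _ _ huv.symm
  · exact proj_cusp_ne_point _ _ huv
  · obtain ⟨g, hg, rfl⟩ := proj_point_eq_iff.1 huv
    have h1 := ne_zero_or_of_isCoprime (isCoprime_smul g h)
    rw [Set.mem_ofPred_eq, ← height_smul g] at hu
    have := eq_of_one_lt_height h1 h0' hu hv
    rw [← cuspOf_eq_iff h1 h0', ← moveCusp_cuspOf g h0] at this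
    exact hne (proj_cusp_eq_iff.2 ⟨g, hg, this⟩).symm

/-- Needed so that a continuous injection of the circle is automatically an embedding. -/
instance (N : ℕ) : T2Space (X0 N) := by
  refine ⟨fun a b => ?_⟩
  obtain ⟨a, rfl⟩ := Quotient.exists_rep a
  obtain ⟨b, rfl⟩ := Quotient.exists_rep b
  change proj N a ≠ proj N b → ∃ U V : Set (X0 N), IsOpen U ∧ IsOpen V ∧ proj N a ∈ U ∧
      proj N b ∈ V ∧ Disjoint U V
  intro hne
  cases a with
  | point z =>
    cases b with
    | point w => exact exists_separate_points N hne
    | cusp d =>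
      obtain ⟨x, y, hxy, rfl⟩ := exists_cuspOf d
      obtain ⟨U, V, hU, hV, h1, h2, h3⟩ :=
        exists_separate_cusp_point N (ne_zero_or_of_isCoprime hxy) z
      exact ⟨V, U, hV, hU, h2, h1, h3.symm⟩
  | cusp c =>
    obtain ⟨x, y, hxy, rfl⟩ := exists_cuspOf c
    cases b with
    | point w => exact exists_separate_cusp_point N (ne_zero_or_of_isCoprime hxy) w
    | cusp d =>
      obtain ⟨x', y', hxy', rfl⟩ := exists_cuspOf d
      exact exists_separate_cusps N hxy hxy' hne

end Topology

/-! ### Equations and parametrizations of geodesics between cusps. -/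

section Geodesics

/-- One equation for lines and half-circles alike: at real `z` its left side is `(y z - x) (y' z -
x')`. -/
lemma mem_geodesic_cuspOf {x y x' y' : ℤ} (h : x * y' - x' * y ≠ 0) (z : ℍ) :
    z ∈ geodesic (cuspOf x y) (cuspOf x' y') ↔
      (y * y' * (z.re ^ 2 + z.im ^ 2) - (x * y' + x' * y) * z.re + x * x' : ℝ) = 0 := by
  unfold cuspOf
  by_cases hy : y = 0 <;> by_cases hy' : y' = 0
  · simp [hy, hy'] at h
  · have hx : x ≠ 0 := by
      rintro rfl
      simp [hy] at h
    have h1 : (x : ℝ) ≠ 0 := by exact_mod_cast hx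
    have h2 : (y' : ℝ) ≠ 0 := by exact_mod_cast hy'
    simp only [hy, hy', if_true, if_false, geodesic, OnePoint.elim_infty, OnePoint.elim_some,
      Set.mem_ofPred_eq]
    push_cast
    rw [eq_div_iff h2]
    constructor
    · intro h
      linear_combination (-x : ℝ) * h
    · intro h
      refine mul_left_cancel₀ h1 ?_
      linear_combination -h
  · have hx : x' ≠ 0 := by
      rintro rfl
      simp [hy'] at h
    have h1 : (x' : ℝ) ≠ 0 := by exact_mod_cast hx
    have h2 : (y : ℝ) ≠ 0 := by exact_mod_cast hy
    simp only [hy, hy', if_true, if_false, geodesic, OnePoint.elim_infty, OnePoint.elim_some,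
      Set.mem_ofPred_eq]
    push_cast
    rw [eq_div_iff h2]
    constructor
    · intro h
      linear_combination (-x' : ℝ) * h
    · intro h
      refine mul_left_cancel₀ h1 ?_
      linear_combination -h
  · have h1 : (y : ℝ) ≠ 0 := by exact_mod_cast hy
    have h2 : (y' : ℝ) ≠ 0 := by exact_mod_cast hy'
    simp only [hy, hy', if_false, geodesic, OnePoint.elim_some, Set.mem_ofPred_eq]
    rw [← sq_eq_sq₀ (norm_nonneg _) (by positivity), div_pow, sq_abs, Complex.sq_norm]
    have e : (z : ℂ) - (((x / y : ℚ) : ℂ) + ((x' / y' : ℚ) : ℂ)) / 2 =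
        ((1 : ℝ) : ℂ) * z - (((x / y + x' / y') / 2 : ℝ) : ℂ) := by
      push_cast
      ring
    rw [e, normSq_mul_sub]
    push_cast
    have key : (1 * z.re - ((x : ℝ) / y + x' / y') / 2) ^ 2 + (1 * z.im) ^ 2 -
        ((x : ℝ) / y - x' / y') ^ 2 / 2 ^ 2 =
        (y * y' * (z.re ^ 2 + z.im ^ 2) - (x * y' + x' * y) * z.re + x * x') / (y * y') := by
      field_simp
      ring
    rw [← sub_eq_zero, key, div_eq_zero_iff, or_iff_left (mul_ne_zero h1 h2)]

/-- For `-1 < t < 1`, the point `(x i τ + x') / (y i τ + y')`, where `τ = (1 + t) / (1 - t)`, of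
the geodesic from `x' / y'` to `x / y`. -/
def geodesicPoint (x y x' y' : ℤ) (t : ℝ) : ℍ :=
  UpperHalfPlane.ofComplex
    ⟨(x * y * (1 + t) ^ 2 + x' * y' * (1 - t) ^ 2) / (y ^ 2 * (1 + t) ^ 2 + y' ^ 2 * (1 - t) ^ 2),
      (x * y' - x' * y) * ((1 + t) * (1 - t)) / (y ^ 2 * (1 + t) ^ 2 + y' ^ 2 * (1 - t) ^ 2)⟩

/-- The complete geodesic from `x' / y'` to `x / y` with its endpoints, parametrized by `[-1, 1]`
and extended by constants. -/
def geodesicPath (x y x' y' : ℤ) (t : ℝ) : ExtHalfPlane :=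
  if 1 ≤ t then cusp (cuspOf x y) else if t ≤ -1 then cusp (cuspOf x' y') else
    point (geodesicPoint x y x' y' t)

variable {x y x' y' : ℤ}

lemma ne_zero_or_of_det_left (h : 0 < x * y' - x' * y) : x ≠ 0 ∨ y ≠ 0 := by
  by_contra! hc
  simp [hc.1, hc.2] at h

lemma ne_zero_or_of_det_right (h : 0 < x * y' - x' * y) : x' ≠ 0 ∨ y' ≠ 0 := by
  by_contra! hc
  simp [hc.1, hc.2] at h

lemma geodesic_denom_pos (h : 0 < x * y' - x' * y) {u v : ℝ} (hu : 0 < u) (hv : 0 < v) :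
    (0 : ℝ) < y ^ 2 * u ^ 2 + y' ^ 2 * v ^ 2 := by
  by_cases hy : y = 0
  · have hy' : (y' : ℝ) ≠ 0 := by
      rintro h0
      have h0' : y' = 0 := by exact_mod_cast h0
      simp [hy, h0'] at h
    have := sq_pos_of_ne_zero hy'
    positivity
  · have hy' : (y : ℝ) ≠ 0 := by exact_mod_cast hy
    have := sq_pos_of_ne_zero hy'
    positivity

lemma geodesicPoint_im_pos (h : 0 < x * y' - x' * y) {t : ℝ} (h1 : -1 < t) (h2 : t < 1) :
    (0 : ℝ) < (x * y' - x' * y) * ((1 + t) * (1 - t)) /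
      (y ^ 2 * (1 + t) ^ 2 + y' ^ 2 * (1 - t) ^ 2) := by
  have hu : 0 < 1 + t := by linarith
  have hv : 0 < 1 - t := by linarith
  have hd : (0 : ℝ) < x * y' - x' * y := by exact_mod_cast h
  have := geodesic_denom_pos h hu hv
  positivity

lemma geodesicPoint_re (h : 0 < x * y' - x' * y) {t : ℝ} (h1 : -1 < t) (h2 : t < 1) :
    (geodesicPoint x y x' y' t).re =
      (x * y * (1 + t) ^ 2 + x' * y' * (1 - t) ^ 2) /
        (y ^ 2 * (1 + t) ^ 2 + y' ^ 2 * (1 - t) ^ 2) := by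
  rw [geodesicPoint, UpperHalfPlane.ofComplex_apply_of_im_pos (geodesicPoint_im_pos h h1 h2)]
  rfl

lemma geodesicPoint_im (h : 0 < x * y' - x' * y) {t : ℝ} (h1 : -1 < t) (h2 : t < 1) :
    (geodesicPoint x y x' y' t).im =
      (x * y' - x' * y) * ((1 + t) * (1 - t)) /
        (y ^ 2 * (1 + t) ^ 2 + y' ^ 2 * (1 - t) ^ 2) := by
  rw [geodesicPoint, UpperHalfPlane.ofComplex_apply_of_im_pos (geodesicPoint_im_pos h h1 h2)]
  rfl

/-- The height is `τ` divided by the determinant. It increases strictly with `t`, which gives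
injectivity of the parametrization, and is unbounded as `t → 1`, which gives continuity at the cusp.
-/
lemma height_geodesicPoint_left (h : 0 < x * y' - x' * y) {t : ℝ} (h1 : -1 < t) (h2 : t < 1) :
    height x y (geodesicPoint x y x' y' t) = (1 + t) / ((x * y' - x' * y : ℤ) * (1 - t)) := by
  have hu : 0 < 1 + t := by linarith
  have hv : 0 < 1 - t := by linarith
  have hd : (0 : ℝ) < x * y' - x' * y := by exact_mod_cast h
  have hD := geodesic_denom_pos h hu hv
  have hE := height_denom_pos (ne_zero_or_of_det_left h) (geodesicPoint x y x' y' t)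
  have hd' := hd.ne'
  push_cast
  rw [height_eq, div_eq_div_iff hE.ne' (by positivity), geodesicPoint_re h h1 h2,
    geodesicPoint_im h h1 h2]
  field_simp
  ring

lemma height_geodesicPoint_right (h : 0 < x * y' - x' * y) {t : ℝ} (h1 : -1 < t) (h2 : t < 1) :
    height x' y' (geodesicPoint x y x' y' t) = (1 - t) / ((x * y' - x' * y : ℤ) * (1 + t)) := by
  have hu : 0 < 1 + t := by linarith
  have hv : 0 < 1 - t := by linarith
  have hd : (0 : ℝ) < x * y' - x' * y := by exact_mod_cast h
  have hD := geodesic_denom_pos h hu hv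
  have hE := height_denom_pos (ne_zero_or_of_det_right h) (geodesicPoint x y x' y' t)
  have hd' := hd.ne'
  push_cast
  rw [height_eq, div_eq_div_iff hE.ne' (by positivity), geodesicPoint_re h h1 h2,
    geodesicPoint_im h h1 h2]
  field_simp
  ring

lemma geodesicPoint_injOn (h : 0 < x * y' - x' * y) :
    Set.InjOn (geodesicPoint x y x' y') (Set.Ioo (-1) 1) := by
  rintro s ⟨hs1, hs2⟩ t ⟨ht1, ht2⟩ hst
  have he := height_geodesicPoint_left h hs1 hs2
  rw [hst, height_geodesicPoint_left h ht1 ht2] at he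
  have hd : (0 : ℝ) < (x * y' - x' * y : ℤ) := by exact_mod_cast h
  have hs : 0 < 1 - s := by linarith
  have ht : 0 < 1 - t := by linarith
  rw [div_eq_div_iff (by positivity) (by positivity)] at he
  have := mul_left_cancel₀ hd.ne' (show ((x * y' - x' * y : ℤ) : ℝ) * ((1 + t) * (1 - s)) =
    (x * y' - x' * y : ℤ) * ((1 + s) * (1 - t)) by linear_combination he)
  linarith

lemma geodesicPoint_mem (h : 0 < x * y' - x' * y) {t : ℝ} (h1 : -1 < t) (h2 : t < 1) :
    geodesicPoint x y x' y' t ∈ geodesic (cuspOf x y) (cuspOf x' y') := by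
  have hu : 0 < 1 + t := by linarith
  have hv : 0 < 1 - t := by linarith
  have hD := geodesic_denom_pos h hu hv
  rw [mem_geodesic_cuspOf h.ne', geodesicPoint_re h h1 h2, geodesicPoint_im h h1 h2]
  field_simp
  ring

lemma exists_geodesicPoint_eq (h : 0 < x * y' - x' * y) {z : ℍ}
    (hz : z ∈ geodesic (cuspOf x y) (cuspOf x' y')) :
    ∃ t : ℝ, -1 < t ∧ t < 1 ∧ geodesicPoint x y x' y' t = z := by
  rw [mem_geodesic_cuspOf h.ne'] at hz
  have hd : (0 : ℝ) < x * y' - x' * y := by exact_mod_cast h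
  have hE := height_denom_pos (ne_zero_or_of_det_left h) z
  have hY := z.im_pos
  set X := z.re with hX
  set Y := z.im with hYd
  -- `τ` must be the determinant times the height of `z` at `x / y`. Then `e1` and `e2` are the real
  -- and imaginary parts of `(y i τ + y') z = x i τ + x'`.
  set τ : ℝ := (x * y' - x' * y) * Y / ((y * X - x) ^ 2 + (y * Y) ^ 2) with hτ
  have hτ0 : 0 < τ := by positivity
  have hτE : τ * ((y * X - x) ^ 2 + (y * Y) ^ 2) = (x * y' - x' * y) * Y := by
    rw [hτ, div_mul_cancel₀ _ hE.ne']
  have e1 : y' * X - y * τ * Y = x' := by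
    refine mul_left_cancel₀ hE.ne' ?_
    linear_combination (-y * Y : ℝ) * hτE + (y * X - x : ℝ) * hz
  have e2 : y * τ * X + y' * Y = x * τ := by
    refine mul_left_cancel₀ hE.ne' ?_
    linear_combination (y * X - x : ℝ) * hτE + (y * Y : ℝ) * hz
  -- The parameter `t` is recovered by inverting `τ = (1 + t) / (1 - t)`.
  have h1 : -1 < (τ - 1) / (τ + 1) := by
    rw [lt_div_iff₀ (by positivity)]
    linarith
  have h2 : (τ - 1) / (τ + 1) < 1 := by
    rw [div_lt_iff₀ (by positivity)]
    linarith
  refine ⟨(τ - 1) / (τ + 1), h1, h2, ?_⟩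
  have hD := geodesic_denom_pos h hτ0 one_pos
  have hu : 1 + (τ - 1) / (τ + 1) = τ * (2 / (τ + 1)) := by
    field_simp
    ring
  have hv : 1 - (τ - 1) / (τ + 1) = 2 / (τ + 1) := by
    field_simp
    ring
  have hw : 0 < 2 / (τ + 1) := by positivity
  have hD' := geodesic_denom_pos h (mul_pos hτ0 hw) hw
  refine UpperHalfPlane.ext_re_im ?_ ?_
  · rw [geodesicPoint_re h h1 h2, hu, hv, div_eq_iff hD'.ne']
    linear_combination (-y' * (2 / (τ + 1)) ^ 2 : ℝ) * e1 - (y * τ * (2 / (τ + 1)) ^ 2 : ℝ) * e2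
  · rw [geodesicPoint_im h h1 h2, hu, hv, div_eq_iff hD'.ne']
    linear_combination (y * τ * (2 / (τ + 1)) ^ 2 : ℝ) * e1 - (y' * (2 / (τ + 1)) ^ 2 : ℝ) * e2

lemma geodesicPath_of_one_le {t : ℝ} (ht : 1 ≤ t) :
    geodesicPath x y x' y' t = cusp (cuspOf x y) := if_pos ht

lemma geodesicPath_of_le_neg_one {t : ℝ} (ht : t ≤ -1) :
    geodesicPath x y x' y' t = cusp (cuspOf x' y') := by
  rw [geodesicPath, if_neg (by linarith), if_pos ht]

lemma geodesicPath_of_mem {t : ℝ} (h1 : -1 < t) (h2 : t < 1) :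
    geodesicPath x y x' y' t = point (geodesicPoint x y x' y' t) := by
  rw [geodesicPath, if_neg h2.not_ge, if_neg h1.not_ge]

lemma continuousAt_geodesicPoint (h : 0 < x * y' - x' * y) {t : ℝ} (h1 : -1 < t) (h2 : t < 1) :
    ContinuousAt (geodesicPoint x y x' y') t := by
  have hu : 0 < 1 + t := by linarith
  have hv : 0 < 1 - t := by linarith
  have hD := (geodesic_denom_pos h hu hv).ne'
  refine ContinuousAt.comp (f := fun t : ℝ => (⟨_, _⟩ : ℂ)) ?_ ?_
  · exact (UpperHalfPlane.contMDiffAt_ofComplex (n := 0)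
      (geodesicPoint_im_pos h h1 h2)).continuousAt
  · refine Complex.equivRealProdCLM.symm.continuous.continuousAt.comp
      (f := fun t : ℝ => (_, _)) ?_
    refine ContinuousAt.prodMk (ContinuousAt.div ?_ ?_ hD) (ContinuousAt.div ?_ ?_ hD) <;> fun_prop

lemma continuous_geodesicPath (h : 0 < x * y' - x' * y) : Continuous (geodesicPath x y x' y') := by
  have hd : (0 : ℝ) < (x * y' - x' * y : ℤ) := by exact_mod_cast h
  refine ⟨fun U hU => isOpen_iff_mem_nhds.2 fun t ht => ?_⟩
  have hU' := isOpen_iff_height.1 hU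
  rcases le_or_gt 1 t with h1 | h1
  · rw [Set.mem_preimage, geodesicPath_of_one_le h1] at ht
    obtain ⟨T, hT, hTU⟩ := hU'.2 _ _ (ne_zero_or_of_det_left h) ht
    -- Negativity of this function is the condition `height > T` with denominators cleared, so that
    -- it still makes sense and holds at `s = 1`.
    have hc : ContinuousAt (fun s : ℝ => T * ((x * y' - x' * y : ℤ) * (1 - s)) - (1 + s)) 1 := by
      fun_prop
    have hev : ∀ᶠ s in nhds (1 : ℝ), T * ((x * y' - x' * y : ℤ) * (1 - s)) - (1 + s) < 0 :=
      hc.eventually_lt_const (by norm_num)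
    have hgen : ∀ s : ℝ, -1 < s →
        T * ((x * y' - x' * y : ℤ) * (1 - s)) - (1 + s) < 0 → geodesicPath x y x' y' s ∈ U := by
      intro s hs hlt
      rcases le_or_gt 1 s with hs' | hs'
      · rwa [geodesicPath_of_one_le hs']
      · rw [geodesicPath_of_mem hs hs']
        refine hTU _ ?_
        rw [height_geodesicPoint_left h hs hs',
          lt_div_iff₀ (mul_pos hd (by linarith : 0 < 1 - s))]
        linarith
    rcases h1.eq_or_lt with rfl | h1
    · filter_upwards [hev, lt_mem_nhds (show (-1 : ℝ) < 1 by norm_num)] with s hs1 hs2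
      exact hgen s hs2 hs1
    · filter_upwards [lt_mem_nhds h1] with s hs
      rwa [Set.mem_preimage, geodesicPath_of_one_le (le_of_lt hs)]
  rcases le_or_gt t (-1) with h2 | h2
  · rw [Set.mem_preimage, geodesicPath_of_le_neg_one h2] at ht
    obtain ⟨T, hT, hTU⟩ := hU'.2 _ _ (ne_zero_or_of_det_right h) ht
    have hc : ContinuousAt (fun s : ℝ => T * ((x * y' - x' * y : ℤ) * (1 + s)) - (1 - s)) (-1) := by
      fun_prop
    have hev : ∀ᶠ s in nhds (-1 : ℝ), T * ((x * y' - x' * y : ℤ) * (1 + s)) - (1 - s) < 0 :=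
      hc.eventually_lt_const (by norm_num)
    have hgen : ∀ s : ℝ, s < 1 →
        T * ((x * y' - x' * y : ℤ) * (1 + s)) - (1 - s) < 0 → geodesicPath x y x' y' s ∈ U := by
      intro s hs hlt
      rcases le_or_gt s (-1) with hs' | hs'
      · rwa [geodesicPath_of_le_neg_one hs']
      · rw [geodesicPath_of_mem hs' hs]
        refine hTU _ ?_
        rw [height_geodesicPoint_right h hs' hs,
          lt_div_iff₀ (mul_pos hd (by linarith : 0 < 1 + s))]
        linarith
    rcases h2.eq_or_lt with rfl | h2
    · filter_upwards [hev, gt_mem_nhds (show (-1 : ℝ) < 1 by norm_num)] with s hs1 hs2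
      exact hgen s hs2 hs1
    · filter_upwards [gt_mem_nhds h2] with s hs
      rwa [Set.mem_preimage, geodesicPath_of_le_neg_one (le_of_lt hs)]
  · rw [Set.mem_preimage, geodesicPath_of_mem h2 h1] at ht
    have hc := (continuousAt_geodesicPoint h h2 h1).preimage_mem_nhds (hU'.1.mem_nhds ht)
    filter_upwards [hc, lt_mem_nhds h2, gt_mem_nhds h1] with s hs1 hs2 hs3
    rwa [Set.mem_preimage, geodesicPath_of_mem hs2 hs3]

lemma geodesicPath_image (h : 0 < x * y' - x' * y) :
    geodesicPath x y x' y' '' Set.Icc (-1) 1 = closedGeodesic (cuspOf x y) (cuspOf x' y') := by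
  ext a
  constructor
  · rintro ⟨t, ⟨h1, h2⟩, rfl⟩
    rcases h2.eq_or_lt with rfl | h2
    · rw [geodesicPath_of_one_le le_rfl]
      exact Or.inr (Or.inl rfl)
    rcases h1.eq_or_lt with rfl | h1
    · rw [geodesicPath_of_le_neg_one le_rfl]
      exact Or.inr (Or.inr rfl)
    rw [geodesicPath_of_mem h1 h2]
    exact Or.inl ⟨_, geodesicPoint_mem h h1 h2, rfl⟩
  · rintro (⟨z, hz, rfl⟩ | rfl | rfl)
    · obtain ⟨t, h1, h2, rfl⟩ := exists_geodesicPoint_eq h hz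
      exact ⟨t, ⟨h1.le, h2.le⟩, geodesicPath_of_mem h1 h2⟩
    · exact ⟨1, by norm_num, geodesicPath_of_one_le le_rfl⟩
    · exact ⟨-1, by norm_num, geodesicPath_of_le_neg_one le_rfl⟩

end Geodesics

/-! ### Gluing two paths to a simple closed curve. -/

section Curves

lemma circle_re_sq_add_im_sq (u : Circle) : (u : ℂ).re ^ 2 + (u : ℂ).im ^ 2 = 1 := by
  have := Circle.normSq_coe u
  rw [Complex.normSq_apply] at this
  linarith

lemma circle_re_mem (u : Circle) : (u : ℂ).re ∈ Set.Icc (-1 : ℝ) 1 := by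
  have := circle_re_sq_add_im_sq u
  constructor <;> nlinarith [sq_nonneg (u : ℂ).im]

/-- Two paths glued along the upper and the lower half of the circle. -/
def glueCircle {X : Type*} (f g : ℝ → X) (u : Circle) : X :=
  if 0 ≤ (u : ℂ).im then f (u : ℂ).re else g (u : ℂ).re

variable {X : Type*} {f g : ℝ → X}

lemma continuous_glueCircle [TopologicalSpace X] (hf : Continuous f) (hg : Continuous g)
    (h1 : f 1 = g 1) (h2 : f (-1) = g (-1)) : Continuous (glueCircle f g) := by
  have hre : Continuous fun u : Circle => (u : ℂ).re := by fun_prop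
  have him : Continuous fun u : Circle => (u : ℂ).im := by fun_prop
  refine Continuous.if_le (hf.comp hre) (hg.comp hre) continuous_const him fun u hu => ?_
  have := circle_re_sq_add_im_sq u
  rw [← hu] at this
  have hc : (u : ℂ).re = 1 ∨ (u : ℂ).re = -1 := by
    rw [← sq_eq_sq_iff_eq_or_eq_neg]
    linarith
  rcases hc with hc | hc <;> simp [hc, h1, h2]

lemma range_glueCircle (h1 : f 1 = g 1) (h2 : f (-1) = g (-1)) :
    Set.range (glueCircle f g) = f '' Set.Icc (-1) 1 ∪ g '' Set.Icc (-1) 1 := by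
  ext a
  constructor
  · rintro ⟨u, rfl⟩
    unfold glueCircle
    split_ifs
    · exact Or.inl ⟨_, circle_re_mem u, rfl⟩
    · exact Or.inr ⟨_, circle_re_mem u, rfl⟩
  · have hmem : ∀ t s : ℝ, t ^ 2 + s ^ 2 = 1 → ∃ u : Circle, (u : ℂ) = ⟨t, s⟩ := fun t s h =>
      ⟨⟨⟨t, s⟩, by
        change _ ∈ Metric.sphere (0 : ℂ) 1
        rw [mem_sphere_zero_iff_norm, ← sq_eq_sq₀ (norm_nonneg _) zero_le_one, Complex.sq_norm,
          Complex.normSq_mk]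
        linarith⟩, rfl⟩
    rintro (⟨t, ⟨ht1, ht2⟩, rfl⟩ | ⟨t, ⟨ht1, ht2⟩, rfl⟩)
    · have hn : 0 ≤ 1 - t ^ 2 := by nlinarith
      obtain ⟨u, hu⟩ := hmem t (√(1 - t ^ 2)) (by rw [Real.sq_sqrt hn]; ring)
      exact ⟨u, by simp [glueCircle, hu, Real.sqrt_nonneg]⟩
    · rcases ht1.eq_or_lt with rfl | ht1
      · obtain ⟨u, hu⟩ := hmem (-1) 0 (by norm_num)
        exact ⟨u, by simp [glueCircle, hu, h2]⟩
      rcases ht2.eq_or_lt with rfl | ht2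
      · obtain ⟨u, hu⟩ := hmem 1 0 (by norm_num)
        exact ⟨u, by simp [glueCircle, hu, h1]⟩
      have hn : 0 < 1 - t ^ 2 := by nlinarith
      obtain ⟨u, hu⟩ := hmem t (-√(1 - t ^ 2)) (by rw [neg_sq, Real.sq_sqrt hn.le]; ring)
      have := Real.sqrt_pos.2 hn
      exact ⟨u, by simp [glueCircle, hu, hn]⟩

/-- The points `±1` of the circle belong to the upper half, so `g` is used only on the open
interval. -/
lemma injective_glueCircle (hf : Set.InjOn f (Set.Icc (-1) 1)) (hg : Set.InjOn g (Set.Icc (-1) 1))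
    (hfg : ∀ s ∈ Set.Icc (-1 : ℝ) 1, ∀ t ∈ Set.Ioo (-1 : ℝ) 1, f s ≠ g t) :
    Function.Injective (glueCircle f g) := by
  have key : ∀ u : Circle, (u : ℂ).im < 0 → (u : ℂ).re ∈ Set.Ioo (-1 : ℝ) 1 := by
    intro u hu
    have := circle_re_sq_add_im_sq u
    constructor <;> nlinarith [sq_pos_of_neg hu]
  intro u w huw
  have hu := circle_re_sq_add_im_sq u
  have hw := circle_re_sq_add_im_sq w
  unfold glueCircle at huw
  split_ifs at huw with hu0 hw0 hw0
  · have := hf (circle_re_mem u) (circle_re_mem w) huw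
    refine Circle.ext (Complex.ext this ?_)
    rw [← sq_eq_sq₀ hu0 hw0]
    rw [this] at hu
    linarith
  · exact absurd huw (hfg _ (circle_re_mem u) _ (key w (not_le.1 hw0)))
  · exact absurd huw.symm (hfg _ (circle_re_mem w) _ (key u (not_le.1 hu0)))
  · have := hg (circle_re_mem u) (circle_re_mem w) huw
    refine Circle.ext (Complex.ext this ?_)
    rw [not_le] at hu0 hw0
    rw [this] at hu
    nlinarith

variable {N : ℕ} {x y x' y' : ℤ}

lemma injOn_proj_geodesicPath (h : 0 < x * y' - x' * y)
    (hne : proj N (cusp (cuspOf x y)) ≠ proj N (cusp (cuspOf x' y')))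
    (hinj : Set.InjOn (fun z => proj N (point z)) (geodesic (cuspOf x y) (cuspOf x' y'))) :
    Set.InjOn (fun t => proj N (geodesicPath x y x' y' t)) (Set.Icc (-1) 1) := by
  rintro s ⟨hs1, hs2⟩ t ⟨ht1, ht2⟩ hst
  dsimp only at hst
  rcases hs2.eq_or_lt with rfl | hs2
  · rw [geodesicPath_of_one_le le_rfl] at hst
    rcases ht2.eq_or_lt with rfl | ht2
    · rfl
    rcases ht1.eq_or_lt with rfl | ht1
    · rw [geodesicPath_of_le_neg_one le_rfl] at hst
      exact absurd hst hne
    · rw [geodesicPath_of_mem ht1 ht2] at hst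
      exact absurd hst (proj_cusp_ne_point _ _)
  rcases hs1.eq_or_lt with rfl | hs1
  · rw [geodesicPath_of_le_neg_one le_rfl] at hst
    rcases ht2.eq_or_lt with rfl | ht2
    · rw [geodesicPath_of_one_le le_rfl] at hst
      exact absurd hst.symm hne
    rcases ht1.eq_or_lt with rfl | ht1
    · rfl
    · rw [geodesicPath_of_mem ht1 ht2] at hst
      exact absurd hst (proj_cusp_ne_point _ _)
  rw [geodesicPath_of_mem hs1 hs2] at hst
  rcases ht2.eq_or_lt with rfl | ht2
  · rw [geodesicPath_of_one_le le_rfl] at hst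
    exact absurd hst.symm (proj_cusp_ne_point _ _)
  rcases ht1.eq_or_lt with rfl | ht1
  · rw [geodesicPath_of_le_neg_one le_rfl] at hst
    exact absurd hst.symm (proj_cusp_ne_point _ _)
  rw [geodesicPath_of_mem ht1 ht2] at hst
  exact geodesicPoint_injOn h ⟨hs1, hs2⟩ ⟨ht1, ht2⟩
    (hinj (geodesicPoint_mem h hs1 hs2) (geodesicPoint_mem h ht1 ht2) hst)

/-- Two geodesics on which the projection is injective, and whose endpoints have the same pair of
distinct images, project onto a simple closed curve. -/
theorem isSimpleClosedCurve_of_geodesics {r s r' s' : ℤ} (h : 0 < x * y' - x' * y)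
    (h' : 0 < r * s' - r' * s)
    (ha : proj N (cusp (cuspOf x y)) = proj N (cusp (cuspOf r s)))
    (hb : proj N (cusp (cuspOf x' y')) = proj N (cusp (cuspOf r' s')))
    (hne : proj N (cusp (cuspOf x y)) ≠ proj N (cusp (cuspOf x' y')))
    (hinj : Set.InjOn (fun z => proj N (point z))
      (geodesic (cuspOf x y) (cuspOf x' y') ∪ geodesic (cuspOf r s) (cuspOf r' s')))
    (hdisj : Disjoint (geodesic (cuspOf x y) (cuspOf x' y'))
      (geodesic (cuspOf r s) (cuspOf r' s'))) :
    IsSimpleClosedCurve (proj N '' (closedGeodesic (cuspOf x y) (cuspOf x' y') ∪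
      closedGeodesic (cuspOf r s) (cuspOf r' s'))) := by
  set f := fun t => proj N (geodesicPath x y x' y' t) with hf
  set g := fun t => proj N (geodesicPath r s r' s' t) with hg
  have h1 : f 1 = g 1 := by
    simp only [hf, hg, geodesicPath_of_one_le le_rfl, ha]
  have h2 : f (-1) = g (-1) := by
    simp only [hf, hg, geodesicPath_of_le_neg_one le_rfl, hb]
  have hcont : Continuous (glueCircle f g) := continuous_glueCircle
    ((continuous_proj N).comp (continuous_geodesicPath h))
    ((continuous_proj N).comp (continuous_geodesicPath h')) h1 h2
  have hginj : Function.Injective (glueCircle f g) := by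
    refine injective_glueCircle
      (injOn_proj_geodesicPath h hne (hinj.mono Set.subset_union_left))
      (injOn_proj_geodesicPath h' (by rwa [← ha, ← hb]) (hinj.mono Set.subset_union_right)) ?_
    rintro a ⟨ha1, ha2⟩ b ⟨hb1, hb2⟩ hab
    simp only [hf, hg, geodesicPath_of_mem hb1 hb2] at hab
    rcases ha2.eq_or_lt with rfl | ha2
    · rw [geodesicPath_of_one_le le_rfl] at hab
      exact proj_cusp_ne_point _ _ hab
    rcases ha1.eq_or_lt with rfl | ha1
    · rw [geodesicPath_of_le_neg_one le_rfl] at hab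
      exact proj_cusp_ne_point _ _ hab
    rw [geodesicPath_of_mem ha1 ha2] at hab
    have m1 := geodesicPoint_mem h ha1 ha2
    have m2 := geodesicPoint_mem h' hb1 hb2
    have := hinj (Or.inl m1) (Or.inr m2) hab
    rw [this] at m1
    exact Set.disjoint_left.1 hdisj m1 m2
  refine ⟨glueCircle f g, (hcont.isClosedEmbedding hginj).isEmbedding, ?_⟩
  rw [range_glueCircle h1 h2, Set.image_union, ← geodesicPath_image h, ← geodesicPath_image h',
    Set.image_image, Set.image_image]

end Curves

/-! ### Entries of products, inverses and reflected matrices. -/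

section Matrices

lemma SL_ext {g h : SL(2, ℤ)} (h00 : g 0 0 = h 0 0) (h01 : g 0 1 = h 0 1) (h10 : g 1 0 = h 1 0)
    (h11 : g 1 1 = h 1 1) : g = h := by
  ext i j
  fin_cases i <;> fin_cases j <;> assumption

lemma SL_mul_00 (g h : SL(2, ℤ)) : (g * h) 0 0 = g 0 0 * h 0 0 + g 0 1 * h 1 0 := by
  simp [Matrix.mul_apply, Fin.sum_univ_two]

lemma SL_mul_01 (g h : SL(2, ℤ)) : (g * h) 0 1 = g 0 0 * h 0 1 + g 0 1 * h 1 1 := by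
  simp [Matrix.mul_apply, Fin.sum_univ_two]

lemma SL_mul_10 (g h : SL(2, ℤ)) : (g * h) 1 0 = g 1 0 * h 0 0 + g 1 1 * h 1 0 := by
  simp [Matrix.mul_apply, Fin.sum_univ_two]

lemma SL_mul_11 (g h : SL(2, ℤ)) : (g * h) 1 1 = g 1 0 * h 0 1 + g 1 1 * h 1 1 := by
  simp [Matrix.mul_apply, Fin.sum_univ_two]

lemma SL_inv_00 (g : SL(2, ℤ)) : g⁻¹ 0 0 = g 1 1 := by
  simp [Matrix.SpecialLinearGroup.coe_inv, Matrix.adjugate_fin_two]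

lemma SL_inv_01 (g : SL(2, ℤ)) : g⁻¹ 0 1 = -g 0 1 := by
  simp [Matrix.SpecialLinearGroup.coe_inv, Matrix.adjugate_fin_two]

lemma SL_inv_10 (g : SL(2, ℤ)) : g⁻¹ 1 0 = -g 1 0 := by
  simp [Matrix.SpecialLinearGroup.coe_inv, Matrix.adjugate_fin_two]

lemma SL_inv_11 (g : SL(2, ℤ)) : g⁻¹ 1 1 = g 0 0 := by
  simp [Matrix.SpecialLinearGroup.coe_inv, Matrix.adjugate_fin_two]

lemma SL_neg_apply (g : SL(2, ℤ)) (i j : Fin 2) : (-g) i j = -(g i j) := rfl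

lemma hat_00 (g : SL(2, ℤ)) : (hat g) 0 0 = g 0 0 := rfl

lemma hat_01 (g : SL(2, ℤ)) : (hat g) 0 1 = -(g 0 1) := rfl

lemma hat_10 (g : SL(2, ℤ)) : (hat g) 1 0 = -(g 1 0) := rfl

lemma hat_11 (g : SL(2, ℤ)) : (hat g) 1 1 = g 1 1 := rfl

lemma hat_mul (g h : SL(2, ℤ)) : hat (g * h) = hat g * hat h := by
  apply SL_ext <;>
  simp only [hat_00, hat_01, hat_10, hat_11, SL_mul_00, SL_mul_01, SL_mul_10, SL_mul_11] <;> ring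

lemma hat_inv (g : SL(2, ℤ)) : hat g⁻¹ = (hat g)⁻¹ := by
  apply SL_ext <;>
  simp only [hat_00, hat_01, hat_10, hat_11, SL_inv_00, SL_inv_01, SL_inv_10, SL_inv_11]

lemma T_zpow_entries (n : ℤ) : (ModularGroup.T ^ n) 0 0 = 1 ∧ (ModularGroup.T ^ n) 0 1 = n ∧
    (ModularGroup.T ^ n) 1 0 = 0 ∧ (ModularGroup.T ^ n) 1 1 = 1 := by
  have hT : (ModularGroup.T ^ n : SL(2, ℤ)).1 = !![1, n; 0, 1] := ModularGroup.coe_T_zpow n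
  simp [hT]

end Matrices

/-! ### Reflections `h ∘ σ`: fixed points and conjugacy. -/

section Reflections

/-- The reflection `z ↦ -conj z` of the upper half-plane. -/
def reflPoint (z : ℍ) : ℍ := ⟨-(starRingEnd ℂ) (z : ℂ), by simpa using z.im_pos⟩

lemma refl_point (z : ℍ) : refl (point z) = point (reflPoint z) := rfl

lemma reflPoint_smul (g : SL(2, ℤ)) (z : ℍ) : reflPoint (g • z) = hat g • reflPoint z := by
  have := refl_smul g (point z)
  simpa [smul_point, refl_point] using this

/-- Clearing the denominator, the imaginary part of the equation gives equality of the diagonal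
entries and the real part gives the geodesic. -/
lemma smul_reflPoint_eq_iff (h : SL(2, ℤ)) (z : ℍ) : h • reflPoint z = z ↔ h 0 0 = h 1 1 ∧
    (h 1 0 * (z.re ^ 2 + z.im ^ 2) - 2 * h 0 0 * z.re + h 0 1 : ℝ) = 0 := by
  have hz := z.im_pos
  rw [UpperHalfPlane.ext_iff, coe_smul_eq, div_eq_iff (denom_ne_zero h _), Complex.ext_iff]
  have e : ((reflPoint z : ℍ) : ℂ) = -(starRingEnd ℂ) (z : ℂ) := rfl
  rw [e]
  simp
  constructor
  · rintro ⟨h1, h2⟩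
    have h3 : (h 0 0 : ℝ) = h 1 1 := by
      refine mul_right_cancel₀ hz.ne' ?_
      linear_combination h2
    refine ⟨by exact_mod_cast h3, ?_⟩
    linear_combination h1 - z.re * h3
  · rintro ⟨h1, h2⟩
    have h3 : (h 0 0 : ℝ) = h 1 1 := by exact_mod_cast h1
    constructor
    · linear_combination h2 + z.re * h3
    · linear_combination z.im * h3

/-- An element of `SL(2, ℤ)` with a fixed point in `ℍ` is elliptic or central. -/
lemma eq_one_or_neg_one_of_smul_eq {g : SL(2, ℤ)} {z : ℍ} (hg : g • z = z)
    (ht : 4 ≤ (g 0 0 + g 1 1) ^ 2) : g = 1 ∨ g = -1 := by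
  have hz := z.im_pos
  have hd := det_eq_one g
  rw [UpperHalfPlane.ext_iff, coe_smul_eq, div_eq_iff (denom_ne_zero g _), Complex.ext_iff] at hg
  simp at hg
  obtain ⟨h1, h2⟩ := hg
  have e1 : (g 0 0 - g 1 1 : ℝ) = 2 * g 1 0 * z.re := by
    refine mul_right_cancel₀ hz.ne' ?_
    linear_combination h2
  have e2 : (g 0 1 : ℝ) = -(g 1 0 * (z.re ^ 2 + z.im ^ 2)) := by
    linear_combination h1 - z.re * e1
  have hd' : (g 0 0 * g 1 1 - g 0 1 * g 1 0 : ℝ) = 1 := by exact_mod_cast hd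
  -- With trace squared at least 4 this forces the lower left entry to vanish.
  have e3 : ((g 0 0 + g 1 1) ^ 2 : ℝ) = 4 - 4 * (g 1 0 * z.im) ^ 2 := by
    linear_combination (g 0 0 - g 1 1 + 2 * g 1 0 * z.re : ℝ) * e1 + 4 * hd' + 4 * g 1 0 * e2
  have ht' : (4 : ℝ) ≤ (g 0 0 + g 1 1) ^ 2 := by exact_mod_cast ht
  have e4 : (g 1 0 : ℝ) * z.im = 0 := by
    have : ((g 1 0 : ℝ) * z.im) ^ 2 = 0 := le_antisymm (by linarith) (sq_nonneg _)
    exact pow_eq_zero_iff two_ne_zero |>.1 this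
  have e5 : (g 1 0 : ℝ) = 0 := (mul_eq_zero.1 e4).resolve_right hz.ne'
  have h10 : g 1 0 = 0 := by exact_mod_cast e5
  have h01 : g 0 1 = 0 := by
    rw [e5] at e2
    simpa using e2
  have h00 : g 0 0 = g 1 1 := by
    rw [e5] at e1
    have : (g 0 0 : ℝ) = g 1 1 := by linear_combination e1
    exact_mod_cast this
  rw [h10, h00, mul_zero, sub_zero] at hd
  rcases mul_self_eq_one_iff.1 hd with h | h
  · left
    apply SL_ext <;> simp [h10, h01, h00, h]
  · right
    apply SL_ext <;> simp [SL_neg_apply, h10, h01, h00, h]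

variable {N : ℕ} {h h' : SL(2, ℤ)}

lemma dvd_sq_sub_one (hh : h ∈ CongruenceSubgroup.Gamma0 N) (e : h 0 0 = h 1 1) :
    (N : ℤ) ∣ h 0 0 ^ 2 - 1 := by
  have hd := det_eq_one h
  refine (Gamma0_dvd.1 hh).trans ⟨h 0 1, ?_⟩
  rw [← e] at hd
  linear_combination hd

/-- Two reflections of `Γ₀(N)` with a common fixed point agree up to sign. -/
lemma eq_or_eq_neg_of_fixed (hN : 4 < N) (hh : h ∈ CongruenceSubgroup.Gamma0 N)
    (hh' : h' ∈ CongruenceSubgroup.Gamma0 N) {z : ℍ} (hz : h • reflPoint z = z)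
    (hz' : h' • reflPoint z = z) : h = h' ∨ h = -h' := by
  have e := ((smul_reflPoint_eq_iff h z).1 hz).1
  have e' := ((smul_reflPoint_eq_iff h' z).1 hz').1
  have hfix : (h * h'⁻¹) • z = z := by
    have : reflPoint z = h'⁻¹ • z := eq_inv_smul_iff.2 hz'
    rw [mul_smul, ← this, hz]
  have ht : 4 ≤ ((h * h'⁻¹) 0 0 + (h * h'⁻¹) 1 1) ^ 2 := by
    set t := (h * h'⁻¹) 0 0 + (h * h'⁻¹) 1 1 with htdef
    have hte : t = 2 * h 0 0 * h' 0 0 - h 0 1 * h' 1 0 - h 1 0 * h' 0 1 := by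
      rw [htdef, SL_mul_00, SL_mul_11, SL_inv_00, SL_inv_01, SL_inv_10, SL_inv_11, ← e, ← e']
      ring
    -- Modulo `N` the trace is `2 a a'` with `a² ≡ a'² ≡ 1`. As `N > 4`, the congruence excludes `t²
    -- < 4`, so the product of the two reflections is not elliptic.
    have hdvd : (N : ℤ) ∣ t ^ 2 - 4 := by
      obtain ⟨k, hk⟩ := dvd_sq_sub_one hh e
      obtain ⟨k', hk'⟩ := dvd_sq_sub_one hh' e'
      obtain ⟨c, hc⟩ := Gamma0_dvd.1 hh
      obtain ⟨c', hc'⟩ := Gamma0_dvd.1 hh'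
      have h1 : t - 2 * h 0 0 * h' 0 0 = N * (-(h 0 1 * c') - c * h' 0 1) := by
        rw [hte, hc, hc']
        ring
      refine ⟨(-(h 0 1 * c') - c * h' 0 1) * (t + 2 * h 0 0 * h' 0 0) +
        4 * (k * h' 0 0 ^ 2 + k'), ?_⟩
      linear_combination (t + 2 * h 0 0 * h' 0 0) * h1 + 4 * h' 0 0 ^ 2 * hk + 4 * hk'
    by_contra! hlt
    have h1 := Int.le_of_dvd (by linarith : 0 < 4 - t ^ 2) (show (N : ℤ) ∣ 4 - t ^ 2 by
      rw [← neg_sub, dvd_neg]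
      exact hdvd)
    have : (4 : ℤ) < N := by exact_mod_cast hN
    nlinarith [sq_nonneg t]
  rcases eq_one_or_neg_one_of_smul_eq hfix ht with h1 | h1
  · exact Or.inl (mul_inv_eq_one.1 h1)
  · right
    rw [mul_inv_eq_iff_eq_mul] at h1
    rw [h1, neg_one_mul]

/-- The matrix `M = (a, -b; c, -a)` satisfies `M² = 1`, so the columns of `M + 1` are fixed by `M`.
A nonzero one, up to sign, is divided by its content. -/
lemma exists_eigenvector {a b c : ℤ} (h : a ^ 2 - b * c = 1) :
    ∃ x y : ℤ, IsCoprime x y ∧ (a - 1) * x = b * y ∧ c * x = (a + 1) * y := by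
  have key : ∃ x y : ℤ, (x ≠ 0 ∨ y ≠ 0) ∧ (a - 1) * x = b * y ∧ c * x = (a + 1) * y := by
    by_cases hc : a + 1 = 0 ∧ c = 0
    · refine ⟨b, a - 1, Or.inr (by omega), by ring, ?_⟩
      linear_combination -h
    · refine ⟨a + 1, c, by tauto, by linear_combination h, by ring⟩
  obtain ⟨x, y, hxy, h1, h2⟩ := key
  have hg : Int.gcd x y ≠ 0 := by
    rw [Ne, Int.gcd_eq_zero_iff]
    tauto
  have hg' : (Int.gcd x y : ℤ) ≠ 0 := by exact_mod_cast hg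
  obtain ⟨u, hu⟩ := Int.gcd_dvd_left x y
  obtain ⟨v, hv⟩ := Int.gcd_dvd_right x y
  refine ⟨u, v, ?_, ?_, ?_⟩
  · refine ⟨Int.gcdA x y, Int.gcdB x y, ?_⟩
    refine mul_left_cancel₀ hg' ?_
    linear_combination -(Int.gcd_eq_gcd_ab x y) - Int.gcdA x y * hu - Int.gcdB x y * hv
  · refine mul_left_cancel₀ hg' ?_
    linear_combination h1 - (a - 1) * hu + b * hv
  · refine mul_left_cancel₀ hg' ?_
    linear_combination h2 - c * hu + (a + 1) * hv

/-- In a basis starting with a primitive fixed vector of `h · diag(1, -1)`, the matrix `h` becomes a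
power of `T`. -/
lemma exists_conj_T_zpow (e : h 0 0 = h 1 1) :
    ∃ (g : SL(2, ℤ)) (k : ℤ), (k = 0 ∨ k = 1) ∧ h * hat g = g * ModularGroup.T ^ k := by
  have hd := det_eq_one h
  have hd' : h 0 0 ^ 2 - h 0 1 * h 1 0 = 1 := by
    linear_combination hd + h 0 0 * e
  obtain ⟨x, y, hxy, h1, h2⟩ := exists_eigenvector hd'
  obtain ⟨g, rfl, rfl⟩ := exists_SL_col hxy
  have hg := det_eq_one g
  set B := g⁻¹ * (h * hat g) with hB
  have B00 : B 0 0 = 1 := by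
    simp only [hB, SL_mul_00, SL_mul_10, SL_inv_00, SL_inv_01, hat_00, hat_10, ← e]
    linear_combination g 1 1 * h1 - g 0 1 * h2 + hg
  have B10 : B 1 0 = 0 := by
    simp only [hB, SL_mul_10, SL_mul_00, SL_inv_10, SL_inv_11, hat_00, hat_10, ← e]
    linear_combination -g 1 0 * h1 + g 0 0 * h2
  have B11 : B 1 1 = 1 := by
    have := det_eq_one B
    rw [B00, B10] at this
    linarith
  have hBT : B = ModularGroup.T ^ (B 0 1) := by
    obtain ⟨t00, t01, t10, t11⟩ := T_zpow_entries (B 0 1)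
    apply SL_ext
    · rw [B00, t00]
    · rw [t01]
    · rw [B10, t10]
    · rw [B11, t11]
  have hhg : h * hat g = g * ModularGroup.T ^ (B 0 1) := by
    rw [← hBT, hB, mul_inv_cancel_left]
  -- Since `hat` inverts `T`, changing `g` to `g * T ^ m` lowers the exponent by `2 m`; only its
  -- parity survives.
  refine ⟨g * ModularGroup.T ^ (B 0 1 / 2), B 0 1 % 2, Int.emod_two_eq_zero_or_one _, ?_⟩
  have hhat : hat (ModularGroup.T ^ (B 0 1 / 2)) = ModularGroup.T ^ (-(B 0 1 / 2)) := by
    obtain ⟨t00, t01, t10, t11⟩ := T_zpow_entries (B 0 1 / 2)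
    obtain ⟨s00, s01, s10, s11⟩ := T_zpow_entries (-(B 0 1 / 2))
    apply SL_ext
    · rw [hat_00, t00, s00]
    · rw [hat_01, t01, s01]
    · rw [hat_10, t10, s10, neg_zero]
    · rw [hat_11, t11, s11]
  rw [hat_mul, ← mul_assoc, hhg, hhat, mul_assoc, mul_assoc, ← zpow_add, ← zpow_add]
  congr 2
  omega

/-- The matrices that are diagonal modulo two. -/
def IsEven (h : SL(2, ℤ)) : Prop := 2 ∣ h 0 1 ∧ 2 ∣ h 1 0

/-- Modulo 2 the off-diagonal entries of `h` are `k` times the squares of the first column of `g`,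
which is not zero modulo 2. -/
lemma isEven_iff_of_conj {g : SL(2, ℤ)} {k : ℤ} (hk : k = 0 ∨ k = 1)
    (hg : h * hat g = g * ModularGroup.T ^ k) : IsEven h ↔ k = 0 := by
  have he : h = g * ModularGroup.T ^ k * (hat g)⁻¹ := by rw [← hg, mul_inv_cancel_right]
  obtain ⟨t00, t01, t10, t11⟩ := T_zpow_entries k
  have h01 : h 0 1 = 2 * (g 0 0 * g 0 1) + k * g 0 0 ^ 2 := by
    rw [he]
    simp only [SL_mul_01, SL_mul_00, SL_inv_01, SL_inv_11, hat_00, hat_01, t00, t01, t10, t11]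
    ring
  have h10 : h 1 0 = 2 * (g 1 0 * g 1 1) + k * g 1 0 ^ 2 := by
    rw [he]
    simp only [SL_mul_11, SL_mul_10, SL_inv_00, SL_inv_10, hat_11, hat_10, t00, t01, t10, t11]
    ring
  rw [IsEven, h01, h10]
  rcases hk with rfl | rfl
  · simp
  · simp only [one_mul, one_ne_zero, iff_false, not_and]
    intro h1 h2
    rw [dvd_add_right (Dvd.intro _ rfl)] at h1 h2
    have h1' := Int.prime_two.dvd_of_dvd_pow h1
    have h2' := Int.prime_two.dvd_of_dvd_pow h2
    have := dvd_sub (h1'.mul_right (g 1 1)) (h2'.mul_left (g 0 1))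
    rw [det_eq_one g] at this
    omega

/-- Reflections of `Γ₀(N)`, `N` odd, with the same upper left entry modulo `N` and the same type
modulo two are conjugate under `Γ₀(N)`. -/
lemma exists_conj (hN : IsCoprime (N : ℤ) 2) (hh : h ∈ CongruenceSubgroup.Gamma0 N)
    (hh' : h' ∈ CongruenceSubgroup.Gamma0 N) (e : h 0 0 = h 1 1) (e' : h' 0 0 = h' 1 1)
    (hmod : (N : ℤ) ∣ h 0 0 - h' 0 0) (hpar : IsEven h ↔ IsEven h') :
    ∃ g ∈ CongruenceSubgroup.Gamma0 N, h * hat g = g * h' := by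
  obtain ⟨g, k, hk, hg⟩ := exists_conj_T_zpow e
  obtain ⟨g', k', hk', hg'⟩ := exists_conj_T_zpow e'
  have hkk : k = k' := by
    rw [isEven_iff_of_conj hk hg, isEven_iff_of_conj hk' hg'] at hpar
    omega
  subst hkk
  have hconj : h * hat (g * g'⁻¹) = g * g'⁻¹ * h' := by
    have : h' = g' * ModularGroup.T ^ k * (hat g')⁻¹ := by rw [← hg', mul_inv_cancel_right]
    rw [hat_mul, hat_inv, ← mul_assoc, hg, this]
    group
  refine ⟨g * g'⁻¹, ?_, hconj⟩
  set γ := g * g'⁻¹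
  -- Modulo `N` this entry reads `-a γ₁₀ ≡ a' γ₁₀`. With `a ≡ a'` and `a² ≡ 1` it gives `2 γ₁₀ ≡ 0`,
  -- and `N` is odd.
  have h10 := congrArg (fun m : SL(2, ℤ) => m 1 0) hconj
  simp only [SL_mul_10, hat_00, hat_10, ← e] at h10
  obtain ⟨c, hc⟩ := Gamma0_dvd.1 hh
  obtain ⟨c', hc'⟩ := Gamma0_dvd.1 hh'
  obtain ⟨m, hm⟩ := hmod
  obtain ⟨n, hn⟩ := dvd_sq_sub_one hh e
  refine Gamma0_dvd.2 (hN.dvd_of_dvd_mul_left ?_)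
  refine ⟨h 0 0 * (m * γ 1 0 + c * γ 0 0 - γ 1 1 * c') - 2 * γ 1 0 * n, ?_⟩
  rw [hc, hc'] at h10
  linear_combination (-2 * γ 1 0) * hn + h 0 0 * γ 1 0 * hm - h 0 0 * h10

lemma fixed_of_conj {g : SL(2, ℤ)} (hg : h * hat g = g * h') {z : ℍ} :
    h' • reflPoint z = z ↔ h • reflPoint (g • z) = g • z := by
  rw [reflPoint_smul, ← mul_smul, hg, mul_smul, smul_left_cancel_iff]

/-- If an element of `Γ₀(N)` maps a fixed point of one reflection to a fixed point of another, then
it conjugates the reflections up to sign. -/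
lemma conj_of_fixed (hN : 4 < N) (hh : h ∈ CongruenceSubgroup.Gamma0 N)
    (hh' : h' ∈ CongruenceSubgroup.Gamma0 N) {g : SL(2, ℤ)}
    (hg : g ∈ CongruenceSubgroup.Gamma0 N) {z : ℍ} (hz : h' • reflPoint z = z)
    (hgz : h • reflPoint (g • z) = g • z) : h * hat g = g * h' ∨ h * hat g = -(g * h') := by
  set k := g * h' * (hat g)⁻¹ with hk
  have hkg : k * hat g = g * h' := by rw [hk, inv_mul_cancel_right]
  have hkN : k ∈ CongruenceSubgroup.Gamma0 N := mul_mem (mul_mem hg hh') (inv_mem (hat_mem hg))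
  rcases eq_or_eq_neg_of_fixed hN hh hkN hgz ((fixed_of_conj hkg).1 hz) with h1 | h1
  · exact Or.inl (h1 ▸ hkg)
  · right
    rw [h1, neg_mul, hkg]

lemma isCoprime_of_mem {g : SL(2, ℤ)} (hg : g ∈ CongruenceSubgroup.Gamma0 N) :
    IsCoprime (N : ℤ) (g 0 0) := by
  obtain ⟨c, hc⟩ := Gamma0_dvd.1 hg
  refine ⟨-(g 0 1 * c), g 1 1, ?_⟩
  linear_combination det_eq_one g + g 0 1 * hc

/-- Modulo `N` the upper left entry of the relation is `h₀₀ g₀₀ ≡ g₀₀ h'₀₀`, and `g₀₀` is a unit. -/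
lemma dvd_of_conj (hh' : h' ∈ CongruenceSubgroup.Gamma0 N)
    {g : SL(2, ℤ)} (hg : g ∈ CongruenceSubgroup.Gamma0 N) (hconj : h * hat g = g * h') :
    (N : ℤ) ∣ h 0 0 - h' 0 0 := by
  refine (isCoprime_of_mem hg).dvd_of_dvd_mul_left ?_
  have h00 := congrArg (fun m : SL(2, ℤ) => m 0 0) hconj
  simp only [SL_mul_00, hat_00, hat_10] at h00
  obtain ⟨c, hc⟩ := Gamma0_dvd.1 hg
  obtain ⟨c', hc'⟩ := Gamma0_dvd.1 hh'
  refine ⟨g 0 1 * c' + h 0 1 * c, ?_⟩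
  linear_combination h00 + g 0 1 * hc' + h 0 1 * hc

lemma isEven_of_conj (e' : h' 0 0 = h' 1 1) {g : SL(2, ℤ)} (hconj : h * hat g = g * h')
    (hev : IsEven h') : IsEven h := by
  have he : h = g * h' * (hat g)⁻¹ := by rw [← hconj, mul_inv_cancel_right]
  obtain ⟨⟨b, hb⟩, ⟨c, hc⟩⟩ := hev
  constructor
  · refine ⟨g 0 0 * g 0 1 * h' 0 0 + g 0 0 ^ 2 * b + g 0 1 ^ 2 * c, ?_⟩
    rw [he]
    simp only [SL_mul_01, SL_mul_00, SL_inv_01, SL_inv_11, hat_00, hat_01, ← e', hb, hc]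
    ring
  · refine ⟨g 1 0 * g 1 1 * h' 0 0 + g 1 0 ^ 2 * b + g 1 1 ^ 2 * c, ?_⟩
    rw [he]
    simp only [SL_mul_11, SL_mul_10, SL_inv_00, SL_inv_10, hat_11, hat_10, ← e', hb, hc]
    ring

lemma isEven_neg : IsEven (-h) ↔ IsEven h := by
  simp [IsEven, SL_neg_apply]

/-- The centralizer of a reflection in `SL(2, ℤ)` is trivial. -/
lemma eq_one_or_neg_one_of_conj_self (e : h 0 0 = h 1 1) {g : SL(2, ℤ)}
    (hconj : h * hat g = g * h) : g = 1 ∨ g = -1 := by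
  have hd := det_eq_one h
  have hg := det_eq_one g
  have h00 := congrArg (fun m : SL(2, ℤ) => m 0 0) hconj
  have h01 := congrArg (fun m : SL(2, ℤ) => m 0 1) hconj
  have h10 := congrArg (fun m : SL(2, ℤ) => m 1 0) hconj
  simp only [SL_mul_00, SL_mul_01, SL_mul_10, hat_00, hat_01, hat_10, hat_11, ← e] at h00 h01 h10
  rw [← e] at hd
  -- The relation says that `g` commutes with `M = h · diag(1, -1)`, so `2 g = m + u M` with `m` the
  -- trace of `g`. Taking determinants gives `m² = u² + 4`, whose only integer solutions have `u =
  -- 0`.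
  set u := h 0 0 * (g 0 0 - g 1 1) + 2 * g 0 1 * h 1 0 with hu
  have e1 : g 0 0 - g 1 1 = u * h 0 0 := by
    rw [hu]
    linear_combination (-(g 0 0 - g 1 1)) * hd + h 1 0 * h01
  have e2 : 2 * g 0 1 = -(u * h 0 1) := by
    rw [hu]
    linear_combination (-2 * g 0 1) * hd - h 0 0 * h01
  have e3 : 2 * g 1 0 = u * h 1 0 := by
    rw [hu]
    linear_combination (-2 * g 1 0) * hd - h 0 0 * h10 + 2 * h 1 0 * h00
  have hm : (g 0 0 + g 1 1) ^ 2 = u ^ 2 + 4 := by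
    linear_combination (g 0 0 - g 1 1 + u * h 0 0) * e1 + 4 * hg + 2 * g 1 0 * e2 -
      (u * h 0 1) * e3 + u ^ 2 * hd
  have hu0 : u = 0 := by
    have hm' : (g 0 0 + g 1 1).natAbs ^ 2 = u.natAbs ^ 2 + 4 := by
      zify
      simpa using hm
    have : u.natAbs = 0 := by
      by_contra hne
      have h1 : u.natAbs < (g 0 0 + g 1 1).natAbs :=
        lt_of_pow_lt_pow_left₀ 2 (Nat.zero_le _) (by omega)
      have h2 : (g 0 0 + g 1 1).natAbs < u.natAbs + 2 := by
        refine lt_of_pow_lt_pow_left₀ 2 (Nat.zero_le _) ?_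
        rw [hm']
        have : 0 < u.natAbs := Nat.pos_of_ne_zero hne
        nlinarith
      have h3 : (g 0 0 + g 1 1).natAbs = u.natAbs + 1 := by omega
      rw [h3] at hm'
      ring_nf at hm'
      omega
    exact Int.natAbs_eq_zero.1 this
  rw [hu0] at e1 e2 e3
  have g10 : g 1 0 = 0 := by linarith
  have g01 : g 0 1 = 0 := by linarith
  have g00 : g 0 0 = g 1 1 := by linarith
  rw [g10, g00, mul_zero, sub_zero] at hg
  rcases mul_self_eq_one_iff.1 hg with h | h
  · left
    apply SL_ext <;> simp [g10, g01, g00, h]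
  · right
    apply SL_ext <;> simp [SL_neg_apply, g10, g01, g00, h]

/-- Such a `g` would reverse the axis of the reflection. It would give `a ≡ -a` modulo `N`, although
`2 a` is prime to `N > 1`. -/
lemma not_conj_self_neg (hN : 4 < N) (hN2 : IsCoprime (N : ℤ) 2)
    (hh : h ∈ CongruenceSubgroup.Gamma0 N) {g : SL(2, ℤ)}
    (hg : g ∈ CongruenceSubgroup.Gamma0 N) : h * hat g ≠ -(g * h) := by
  intro hconj
  have h1 := dvd_of_conj hh hg (by rw [neg_mul, hconj, neg_neg])
  have h2 : (N : ℤ) ∣ 2 * h 0 0 := by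
    rw [SL_neg_apply] at h1
    obtain ⟨k, hk⟩ := h1
    exact ⟨-k, by linear_combination -hk⟩
  have h3 := isCoprime_zero_right.1 (show IsCoprime (N : ℤ) 0 by
    have := (hN2.mul_right (isCoprime_of_mem hh))
    have h4 := this.isUnit_of_dvd' dvd_rfl h2
    exact isCoprime_zero_right.2 h4)
  rw [Int.isUnit_iff] at h3
  omega

/-- The entries of `h` are the coefficients of the geodesic's equation, scaled to determinant one;
they are used below with endpoint determinants 1 and 2. -/
lemma mem_geodesic_iff_fixed {x y x' y' : ℤ} (hδ : 0 < x * y' - x' * y) (e : h 0 0 = h 1 1)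
    (h00 : (x * y' - x' * y) * h 0 0 = x * y' + x' * y)
    (h01 : (x * y' - x' * y) * h 0 1 = 2 * (x * x'))
    (h10 : (x * y' - x' * y) * h 1 0 = 2 * (y * y')) (z : ℍ) :
    z ∈ geodesic (cuspOf x y) (cuspOf x' y') ↔ h • reflPoint z = z := by
  rw [mem_geodesic_cuspOf hδ.ne', smul_reflPoint_eq_iff, and_iff_right e]
  have hδ' : (0 : ℝ) < x * y' - x' * y := by exact_mod_cast hδ
  have r00 : (x * y' - x' * y : ℝ) * h 0 0 = x * y' + x' * y := by exact_mod_cast h00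
  have r01 : (x * y' - x' * y : ℝ) * h 0 1 = 2 * (x * x') := by exact_mod_cast h01
  have r10 : (x * y' - x' * y : ℝ) * h 1 0 = 2 * (y * y') := by exact_mod_cast h10
  constructor
  · intro hz
    refine mul_left_cancel₀ hδ'.ne' ?_
    linear_combination 2 * hz + (z.re ^ 2 + z.im ^ 2) * r10 - 2 * z.re * r00 + r01
  · intro hz
    linear_combination (x * y' - x' * y : ℝ) / 2 * hz - (z.re ^ 2 + z.im ^ 2) / 2 * r10 +
      z.re * r00 - r01 / 2

end Reflections

/-! ### The four geodesics and their reflections. -/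

section Configuration

/-- The first endpoints of the four geodesics, for integers with `X q - Y p = 1`. -/
def firstEnd (p : ℕ) (X : ℤ) : Fin 2 → Fin 2 → OnePoint ℚ :=
  ![![cuspOf 1 0, cuspOf 1 0], ![cuspOf X p, cuspOf (2 * X) p]]

/-- The second endpoints of the four geodesics, for integers with `X q - Y p = 1`. -/
def secondEnd (q : ℕ) (Y : ℤ) : Fin 2 → Fin 2 → OnePoint ℚ :=
  ![![cuspOf 0 1, cuspOf 1 2], ![cuspOf Y q, cuspOf (2 * Y) q]]

/-- The image in `X₀(pq)` of a pair of closed geodesics. -/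
def curve (p q : ℕ) (X Y : ℤ) (i : Fin 2) : Set (X0 (p * q)) :=
  proj (p * q) '' (closedGeodesic (firstEnd p X i 0) (secondEnd q Y i 0) ∪
    closedGeodesic (firstEnd p X i 1) (secondEnd q Y i 1))

variable {p q : ℕ} {X Y : ℤ}

/-- One reflection for each pair of invariants. The entry `X q + Y p` is `1` modulo `p` and `-1`
modulo `q`. Endpoint determinant 1 gives even off-diagonal entries; doubling the numerators, or
replacing `0 / 1` by `1 / 2`, makes the determinant 2 and an off-diagonal entry odd. -/
lemma exists_reflections (hp2 : ¬ 2 ∣ (p : ℤ)) (hq2 : ¬ 2 ∣ (q : ℤ)) (hXY : X * q - Y * p = 1) :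
    ∃ H : Fin 2 → Fin 2 → SL(2, ℤ), (∀ i j, H i j ∈ CongruenceSubgroup.Gamma0 (p * q)) ∧
      (∀ i j, H i j 0 0 = H i j 1 1) ∧ (∀ j, H 0 j 0 0 = 1) ∧
      (∀ j, H 1 j 0 0 = X * q + Y * p) ∧ (∀ i j, IsEven (H i j) ↔ j = 0) ∧
      ∀ i j z, z ∈ geodesic (firstEnd p X i j) (secondEnd q Y i j) ↔
        H i j • reflPoint z = z := by
  obtain ⟨t00, t01, t10, t11⟩ := T_zpow_entries 1
  rw [zpow_one] at t00 t01 t10 t11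
  have hodd : ¬ (2 : ℤ) ∣ p * q := fun h => (Int.prime_two.dvd_or_dvd h).elim hp2 hq2
  let A : SL(2, ℤ) := ⟨!![X * q + Y * p, 2 * (X * Y); 2 * (p * q), X * q + Y * p], by
    rw [Matrix.det_fin_two_of]
    linear_combination (X * q - Y * p + 1) * hXY⟩
  let B : SL(2, ℤ) := ⟨!![X * q + Y * p, 4 * (X * Y); p * q, X * q + Y * p], by
    rw [Matrix.det_fin_two_of]
    linear_combination (X * q - Y * p + 1) * hXY⟩
  have A00 : A 0 0 = X * q + Y * p := rfl
  have A01 : A 0 1 = 2 * (X * Y) := rfl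
  have A10 : A 1 0 = 2 * (p * q) := rfl
  have A11 : A 1 1 = X * q + Y * p := rfl
  have B00 : B 0 0 = X * q + Y * p := rfl
  have B01 : B 0 1 = 4 * (X * Y) := rfl
  have B10 : B 1 0 = p * q := rfl
  have B11 : B 1 1 = X * q + Y * p := rfl
  refine ⟨![![1, ModularGroup.T], ![A, B]], ?_, ?_, ?_, ?_, ?_, ?_⟩
  · simp only [Fin.forall_fin_two, Matrix.cons_val_zero, Matrix.cons_val_one, Gamma0_dvd]
    refine ⟨⟨by simp, by simp [t10]⟩, ?_, ?_⟩
    · rw [A10]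
      push_cast
      exact Dvd.intro_left _ rfl
    · rw [B10]
      push_cast
      exact dvd_rfl
  · simp only [Fin.forall_fin_two, Matrix.cons_val_zero, Matrix.cons_val_one]
    exact ⟨⟨by simp, by rw [t00, t11]⟩, rfl, rfl⟩
  · simp only [Fin.forall_fin_two, Matrix.cons_val_zero, Matrix.cons_val_one]
    exact ⟨by simp, t00⟩
  · simp only [Fin.forall_fin_two, Matrix.cons_val_zero, Matrix.cons_val_one]
    exact ⟨rfl, rfl⟩
  · simp only [Fin.forall_fin_two, Matrix.cons_val_zero, Matrix.cons_val_one, IsEven]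
    refine ⟨⟨by simp, by simp [t01]⟩, ?_, ?_⟩
    · rw [A01, A10]
      simp
    · rw [B01, B10]
      simp [hodd]
  · simp only [Fin.forall_fin_two, Matrix.cons_val_zero, Matrix.cons_val_one, firstEnd, secondEnd]
    refine ⟨⟨?_, ?_⟩, ?_, ?_⟩
    · exact mem_geodesic_iff_fixed (by norm_num) rfl rfl rfl rfl
    · exact mem_geodesic_iff_fixed (by norm_num) (by rw [t00, t11]) (by rw [t00]; norm_num)
        (by rw [t01]; norm_num) (by rw [t10]; norm_num)
    · exact mem_geodesic_iff_fixed (by linarith) rfl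
        (by rw [A00]; linear_combination (X * q + Y * p) * hXY)
        (by rw [A01]; linear_combination (2 * X * Y) * hXY)
        (by rw [A10]; linear_combination (2 * p * q) * hXY)
    · exact mem_geodesic_iff_fixed (by linarith) rfl
        (by rw [B00]; linear_combination 2 * (X * q + Y * p) * hXY)
        (by rw [B01]; linear_combination (8 * X * Y) * hXY)
        (by rw [B10]; linear_combination (2 * p * q) * hXY)

lemma not_two_dvd {p : ℕ} (hp : p.Prime) (hp2 : p ≠ 2) : ¬ 2 ∣ (p : ℤ) := by
  intro h
  have : 2 ∣ p := by exact_mod_cast h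
  exact hp2 ((Nat.prime_dvd_prime_iff_eq Nat.prime_two hp).1 this).symm

end Configuration

/-! ### The four cusps of `X₀(pq)`. -/

section CuspClasses

variable {p q : ℕ} {X Y : ℤ}

lemma proj_cuspOf_eq_iff (hp : p.Prime) (hq : q.Prime) (hpq : p ≠ q) {x y x' y' : ℤ}
    (h : IsCoprime x y) (h' : IsCoprime x' y') :
    proj (p * q) (cusp (cuspOf x y)) = proj (p * q) (cusp (cuspOf x' y')) ↔
      ((p : ℤ) ∣ y ↔ (p : ℤ) ∣ y') ∧ ((q : ℤ) ∣ y ↔ (q : ℤ) ∣ y') := by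
  constructor
  · intro he
    exact ⟨dvd_iff_of_proj_eq h h' he (by push_cast; exact Dvd.intro _ rfl),
      dvd_iff_of_proj_eq h h' he (by push_cast; exact Dvd.intro_left _ rfl)⟩
  · rintro ⟨h1, h2⟩
    exact proj_cusp_eq_iff.2 (exists_moveCusp_eq hp hq hpq h' h h1.symm h2.symm)

lemma not_dvd_prime {p q : ℕ} (hp : p.Prime) (hq : q.Prime) (hpq : p ≠ q) : ¬ (p : ℤ) ∣ q := by
  rw [Int.natCast_dvd_natCast, Nat.prime_dvd_prime_iff_eq hp hq]
  exact hpq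

lemma not_prime_dvd_two {p : ℕ} (hp : p.Prime) (hp2 : p ≠ 2) : ¬ (p : ℤ) ∣ 2 := by
  have := not_dvd_prime hp Nat.prime_two hp2
  exact_mod_cast this

lemma not_prime_dvd_one {p : ℕ} (hp : p.Prime) : ¬ (p : ℤ) ∣ 1 :=
  (Nat.prime_iff_prime_int.1 hp).not_dvd_one

lemma isCoprime_two_left {p : ℕ} (hp : p.Prime) (hp2 : p ≠ 2) : IsCoprime (2 : ℤ) p :=
  (Int.prime_two.coprime_iff_not_dvd).2 (not_two_dvd hp hp2)

lemma isCoprime_one_zero : IsCoprime (1 : ℤ) 0 := isCoprime_one_left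

lemma isCoprime_zero_one : IsCoprime (0 : ℤ) 1 := isCoprime_one_right

lemma isCoprime_first (hXY : X * q - Y * p = 1) : IsCoprime X p :=
  ⟨q, -Y, by linear_combination hXY⟩

lemma isCoprime_second (hXY : X * q - Y * p = 1) : IsCoprime Y q :=
  ⟨-p, X, by linear_combination hXY⟩

/-- The four cusps of `X₀(pq)`: a representative of each class. -/
lemma proj_cusp_cases (hp : p.Prime) (hq : q.Prime) (hpq : p ≠ q) (hXY : X * q - Y * p = 1)
    (c : OnePoint ℚ) : ∃ i, proj (p * q) (cusp c) = proj (p * q) (cusp (firstEnd p X i 0)) ∨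
      proj (p * q) (cusp c) = proj (p * q) (cusp (secondEnd q Y i 0)) := by
  obtain ⟨x, y, hxy, rfl⟩ := exists_cuspOf c
  have hpq' := not_dvd_prime hp hq hpq
  have hqp' := not_dvd_prime hq hp hpq.symm
  have hp1 := not_prime_dvd_one hp
  have hq1 := not_prime_dvd_one hq
  by_cases h1 : (p : ℤ) ∣ y <;> by_cases h2 : (q : ℤ) ∣ y
  · exact ⟨0, Or.inl ((proj_cuspOf_eq_iff hp hq hpq hxy isCoprime_one_zero).2
      (by simp [h1, h2]))⟩
  · exact ⟨1, Or.inl ((proj_cuspOf_eq_iff hp hq hpq hxy (isCoprime_first hXY)).2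
      (by simp [h1, h2, hqp']))⟩
  · exact ⟨1, Or.inr ((proj_cuspOf_eq_iff hp hq hpq hxy (isCoprime_second hXY)).2
      (by simp [h1, h2, hpq']))⟩
  · exact ⟨0, Or.inr ((proj_cuspOf_eq_iff hp hq hpq hxy isCoprime_zero_one).2
      (by simp only [h1, h2, hp1, hq1, and_self]))⟩

lemma proj_firstEnd (hp : p.Prime) (hq : q.Prime) (hpq : p ≠ q) (hp2 : p ≠ 2)
    (hXY : X * q - Y * p = 1) (i : Fin 2) :
    proj (p * q) (cusp (firstEnd p X i 0)) = proj (p * q) (cusp (firstEnd p X i 1)) := by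
  revert i
  rw [Fin.forall_fin_two]
  exact ⟨rfl, (proj_cuspOf_eq_iff hp hq hpq (isCoprime_first hXY)
    ((isCoprime_two_left hp hp2).mul_left (isCoprime_first hXY))).2 ⟨Iff.rfl, Iff.rfl⟩⟩

lemma proj_secondEnd (hp : p.Prime) (hq : q.Prime) (hpq : p ≠ q) (hp2 : p ≠ 2) (hq2 : q ≠ 2)
    (hXY : X * q - Y * p = 1) (i : Fin 2) :
    proj (p * q) (cusp (secondEnd q Y i 0)) = proj (p * q) (cusp (secondEnd q Y i 1)) := by
  revert i
  rw [Fin.forall_fin_two]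
  refine ⟨(proj_cuspOf_eq_iff hp hq hpq
    isCoprime_zero_one
    (isCoprime_one_left : IsCoprime (1 : ℤ) 2)).2 ⟨?_, ?_⟩,
    (proj_cuspOf_eq_iff hp hq hpq (isCoprime_second hXY)
      ((isCoprime_two_left hq hq2).mul_left (isCoprime_second hXY))).2 ⟨Iff.rfl, Iff.rfl⟩⟩
  · exact iff_of_false (not_prime_dvd_one hp) (not_prime_dvd_two hp hp2)
  · exact iff_of_false (not_prime_dvd_one hq) (not_prime_dvd_two hq hq2)

lemma proj_firstEnd_injective (hp : p.Prime) (hq : q.Prime) (hpq : p ≠ q)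
    (hXY : X * q - Y * p = 1) :
    proj (p * q) (cusp (firstEnd p X 0 0)) ≠ proj (p * q) (cusp (firstEnd p X 1 0)) := by
  intro h
  have := ((proj_cuspOf_eq_iff hp hq hpq isCoprime_one_zero (isCoprime_first hXY)).1 h).2
  exact not_dvd_prime hq hp hpq.symm (this.1 (dvd_zero _))

lemma proj_secondEnd_injective (hp : p.Prime) (hq : q.Prime) (hpq : p ≠ q)
    (hXY : X * q - Y * p = 1) :
    proj (p * q) (cusp (secondEnd q Y 0 0)) ≠ proj (p * q) (cusp (secondEnd q Y 1 0)) := by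
  intro h
  have := ((proj_cuspOf_eq_iff hp hq hpq isCoprime_zero_one (isCoprime_second hXY)).1 h).2
  exact not_prime_dvd_one hq (this.2 dvd_rfl)

lemma proj_firstEnd_ne_secondEnd (hp : p.Prime) (hq : q.Prime) (hpq : p ≠ q)
    (hXY : X * q - Y * p = 1) (i j : Fin 2) :
    proj (p * q) (cusp (firstEnd p X i 0)) ≠ proj (p * q) (cusp (secondEnd q Y j 0)) := by
  have hp1 := not_prime_dvd_one hp
  have hpq' := not_dvd_prime hp hq hpq
  have hX := isCoprime_first hXY
  have hY := isCoprime_second hXY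
  revert i j
  simp only [Fin.forall_fin_two]
  refine ⟨⟨fun h => ?_, fun h => ?_⟩, fun h => ?_, fun h => ?_⟩
  · exact hp1 (((proj_cuspOf_eq_iff hp hq hpq isCoprime_one_zero isCoprime_zero_one).1 h).1.1
      (dvd_zero _))
  · exact hpq' (((proj_cuspOf_eq_iff hp hq hpq isCoprime_one_zero hY).1 h).1.1 (dvd_zero _))
  · exact hp1 (((proj_cuspOf_eq_iff hp hq hpq hX isCoprime_zero_one).1 h).1.1 dvd_rfl)
  · exact hpq' (((proj_cuspOf_eq_iff hp hq hpq hX hY).1 h).1.1 dvd_rfl)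

lemma cusps_subset_fixSet (hp : p.Prime) (hq : q.Prime) (hpq : p ≠ q) :
    cusps (p * q) ⊆ fixSet (p * q) := by
  rintro _ ⟨c, rfl⟩
  obtain ⟨x, y, hxy, rfl⟩ := exists_cuspOf c
  change sigma _ _ = _
  rw [sigma_proj, refl_cuspOf]
  -- The reflection changes only the numerator.
  exact (proj_cuspOf_eq_iff hp hq hpq hxy.neg_left hxy).2 ⟨Iff.rfl, Iff.rfl⟩

end CuspClasses

/-! ### Covering, injectivity and the two curves. -/

section Configuration

variable {p q : ℕ} {X Y : ℤ}

lemma isCoprime_mul_two (hp : p.Prime) (hq : q.Prime) (hp2 : p ≠ 2) (hq2 : q ≠ 2) :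
    IsCoprime ((p * q : ℕ) : ℤ) 2 := by
  push_cast
  exact ((isCoprime_two_left hp hp2).mul_right (isCoprime_two_left hq hq2)).symm

lemma four_lt_mul (hp : p.Prime) (hq : q.Prime) (hp2 : p ≠ 2) (hq2 : q ≠ 2) : 4 < p * q := by
  have h1 : 3 ≤ p := by have := hp.two_le; omega
  have h2 : 3 ≤ q := by have := hq.two_le; omega
  nlinarith

/-- Points of the four geodesics that are equivalent under `Γ₀(pq)` are equal and lie on the same
geodesic. -/
lemma eq_of_mem_geodesics (hp : p.Prime) (hq : q.Prime) (hp2 : p ≠ 2) (hq2 : q ≠ 2)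
    (hXY : X * q - Y * p = 1) {i j k l : Fin 2} {z w : ℍ}
    (hz : z ∈ geodesic (firstEnd p X i j) (secondEnd q Y i j))
    (hw : w ∈ geodesic (firstEnd p X k l) (secondEnd q Y k l))
    (hzw : proj (p * q) (point z) = proj (p * q) (point w)) : i = k ∧ j = l ∧ z = w := by
  obtain ⟨H, hmem, hdiag, h0, h1, heven, hgeo⟩ :=
    exists_reflections (not_two_dvd hp hp2) (not_two_dvd hq hq2) hXY
  have hN := four_lt_mul hp hq hp2 hq2
  have hN2 := isCoprime_mul_two hp hq hp2 hq2
  obtain ⟨g, hg, rfl⟩ := proj_point_eq_iff.1 hzw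
  rw [hgeo] at hz hw
  have hconj := conj_of_fixed hN (hmem i j) (hmem k l) hg hw hz
  -- The sign is moved to the first reflection, so that both cases are genuine conjugacies.
  have hconj' : H i j * hat g = g * H k l ∨ -H i j * hat g = g * H k l := by
    refine hconj.imp_right fun h => ?_
    rw [neg_mul, h, neg_neg]
  have hjl : j = l := by
    have hiff : IsEven (H i j) ↔ IsEven (H k l) := by
      have hinv : ∀ m : SL(2, ℤ), m * hat g = g * H k l → H k l * hat g⁻¹ = g⁻¹ * m := by
        intro m hm
        rw [hat_inv, mul_inv_eq_iff_eq_mul, mul_assoc, hm, inv_mul_cancel_left]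
      constructor
      · intro he
        rcases hconj' with h | h
        · exact isEven_of_conj (hdiag i j) (hinv _ h) he
        · refine isEven_of_conj ?_ (hinv _ h) (isEven_neg.2 he)
          rw [SL_neg_apply, SL_neg_apply, hdiag]
      · intro he
        rcases hconj' with h | h
        · exact isEven_of_conj (hdiag k l) h he
        · exact isEven_neg.1 (isEven_of_conj (hdiag k l) h he)
    rw [heven, heven] at hiff
    omega
  have hdvd : ((p * q : ℕ) : ℤ) ∣ H i j 0 0 - H k l 0 0 ∨
      ((p * q : ℕ) : ℤ) ∣ H i j 0 0 + H k l 0 0 := by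
    refine hconj'.imp (dvd_of_conj (hmem k l) hg) fun h => ?_
    have := dvd_of_conj (hmem k l) hg h
    rw [SL_neg_apply] at this
    obtain ⟨m, hm⟩ := this
    exact ⟨-m, by linear_combination -hm⟩
  push_cast at hdvd
  -- The first number is `2` modulo `q` and the second is `2` modulo `p`.
  have hcross : ¬ ((p : ℤ) * q ∣ 1 - (X * q + Y * p)) ∧ ¬ ((p : ℤ) * q ∣ 1 + (X * q + Y * p)) := by
    constructor
    · intro h
      obtain ⟨m, hm⟩ := h
      exact not_prime_dvd_two hq hq2 ⟨p * m + 2 * X, by linear_combination hm - hXY⟩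
    · intro h
      obtain ⟨m, hm⟩ := h
      exact not_prime_dvd_two hp hp2 ⟨q * m - 2 * Y, by linear_combination hm - hXY⟩
  have hik : i = k := by
    have hi : i = 0 ∨ i = 1 := by omega
    have hk : k = 0 ∨ k = 1 := by omega
    rcases hi with rfl | rfl <;> rcases hk with rfl | rfl
    · rfl
    · rw [h0, h1] at hdvd
      exact absurd hdvd (not_or.2 hcross)
    · rw [h0, h1, ← dvd_neg, neg_sub, add_comm _ 1] at hdvd
      exact absurd hdvd (not_or.2 hcross)
    · rfl
  subst hik hjl
  refine ⟨rfl, rfl, ?_⟩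
  rcases hconj with h | h
  · rcases eq_one_or_neg_one_of_conj_self (hdiag i j) h with rfl | rfl
    · rw [one_smul]
    · rw [ModularGroup.SL_neg_smul, one_smul]
  · exact absurd h (not_conj_self_neg hN hN2 (hmem i j) hg)

lemma exists_smul_mem_geodesic_of_dvd (hp : p.Prime) (hq : q.Prime) (hpq : p ≠ q) (hp2 : p ≠ 2)
    (hq2 : q ≠ 2) (hXY : X * q - Y * p = 1) {h : SL(2, ℤ)}
    (hh : h ∈ CongruenceSubgroup.Gamma0 (p * q)) {z : ℍ} (hz : h • reflPoint z = z)
    (hdvd : (p : ℤ) ∣ h 0 0 - 1) :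
    ∃ i j, ∃ w ∈ geodesic (firstEnd p X i j) (secondEnd q Y i j),
      proj (p * q) (point z) = proj (p * q) (point w) := by
  obtain ⟨H, hmem, hdiag, h0, h1, heven, hgeo⟩ :=
    exists_reflections (not_two_dvd hp hp2) (not_two_dvd hq hq2) hXY
  have hN2 := isCoprime_mul_two hp hq hp2 hq2
  have hcop : IsCoprime (p : ℤ) (q : ℤ) :=
    Nat.isCoprime_iff_coprime.2 ((Nat.coprime_primes hp hq).2 hpq)
  have e := ((smul_reflPoint_eq_iff h z).1 hz).1
  have hsq := dvd_sq_sub_one hh e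
  have hq' : (q : ℤ) ∣ (h 0 0 - 1) * (h 0 0 + 1) := by
    refine dvd_trans ?_ (hsq.trans (dvd_of_eq (by ring)))
    push_cast
    exact Dvd.intro_left _ rfl
  -- The sign of `h₀₀ ≡ ±1` modulo `q` selects the curve; parity then selects the geodesic.
  have hi : ∃ i : Fin 2, ∀ j, ((p * q : ℕ) : ℤ) ∣ h 0 0 - H i j 0 0 := by
    push_cast
    rcases (Nat.prime_iff_prime_int.1 hq).dvd_or_dvd hq' with h2 | h2
    · refine ⟨0, fun j => ?_⟩
      rw [h0]
      exact hcop.mul_dvd hdvd h2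
    · refine ⟨1, fun j => ?_⟩
      rw [h1]
      obtain ⟨m, hm⟩ := hdvd
      obtain ⟨n, hn⟩ := h2
      refine hcop.mul_dvd ⟨m - 2 * Y, ?_⟩ ⟨n - 2 * X, ?_⟩
      · linear_combination hm - hXY
      · linear_combination hn + hXY
  obtain ⟨i, hi⟩ := hi
  have hj : ∃ j : Fin 2, IsEven h ↔ IsEven (H i j) := by
    by_cases hev : IsEven h
    · exact ⟨0, iff_of_true hev ((heven i 0).2 rfl)⟩
    · exact ⟨1, iff_of_false hev fun h => one_ne_zero ((heven i 1).1 h)⟩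
  obtain ⟨j, hj⟩ := hj
  obtain ⟨g, hg, hconj⟩ := exists_conj hN2 hh (hmem i j) e (hdiag i j) (hi j) hj
  refine ⟨i, j, g⁻¹ • z, ?_, proj_point_eq_iff.2 ⟨g, hg, smul_inv_smul g z⟩⟩
  rw [hgeo, fixed_of_conj hconj, smul_inv_smul]
  exact hz

/-- A point of `X₀(pq)` fixed by the involution lies on the image of one of the four geodesics. -/
lemma exists_mem_geodesic_of_fixed (hp : p.Prime) (hq : q.Prime) (hpq : p ≠ q) (hp2 : p ≠ 2)
    (hq2 : q ≠ 2) (hXY : X * q - Y * p = 1) {z : ℍ}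
    (hz : proj (p * q) (point z) ∈ fixSet (p * q)) :
    ∃ i j, ∃ w ∈ geodesic (firstEnd p X i j) (secondEnd q Y i j),
      proj (p * q) (point z) = proj (p * q) (point w) := by
  have hz' : proj (p * q) (point z) = proj (p * q) (point (reflPoint z)) := by
    have : sigma (p * q) (proj (p * q) (point z)) = proj (p * q) (point z) := hz
    rw [sigma_proj, refl_point] at this
    exact this.symm
  obtain ⟨h, hh, hfix⟩ := proj_point_eq_iff.1 hz'
  have e := ((smul_reflPoint_eq_iff h z).1 hfix).1
  have hp' : (p : ℤ) ∣ (h 0 0 - 1) * (h 0 0 + 1) := by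
    refine dvd_trans ?_ ((dvd_sq_sub_one hh e).trans (dvd_of_eq (by ring)))
    push_cast
    exact Dvd.intro _ rfl
  rcases (Nat.prime_iff_prime_int.1 hp).dvd_or_dvd hp' with h1 | h1
  · exact exists_smul_mem_geodesic_of_dvd hp hq hpq hp2 hq2 hXY hh hfix h1
  -- `-h` acts as `h` does, and its upper left entry is `1` modulo `p`.
  · refine exists_smul_mem_geodesic_of_dvd hp hq hpq hp2 hq2 hXY (h := -h) ?_ ?_ ?_
    · rw [Gamma0_dvd, SL_neg_apply, dvd_neg]
      exact Gamma0_dvd.1 hh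
    · rw [ModularGroup.SL_neg_smul, hfix]
    · rw [SL_neg_apply, ← dvd_neg]
      convert h1 using 1
      abel

lemma mem_fixSet_of_mem_geodesic (hp : p.Prime) (hq : q.Prime) (hp2 : p ≠ 2) (hq2 : q ≠ 2)
    (hXY : X * q - Y * p = 1) {i j : Fin 2} {z : ℍ}
    (hz : z ∈ geodesic (firstEnd p X i j) (secondEnd q Y i j)) :
    proj (p * q) (point z) ∈ fixSet (p * q) := by
  obtain ⟨H, hmem, -, -, -, -, hgeo⟩ :=
    exists_reflections (not_two_dvd hp hp2) (not_two_dvd hq hq2) hXY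
  change sigma _ _ = _
  rw [sigma_proj, refl_point]
  exact (proj_point_eq_iff.2 ⟨H i j, hmem i j, (hgeo i j z).1 hz⟩).symm

/-- The ends of the second geodesic add no further cusps, having the same images as those of the
first. -/
lemma mem_curve_iff (hp : p.Prime) (hq : q.Prime) (hpq : p ≠ q) (hp2 : p ≠ 2) (hq2 : q ≠ 2)
    (hXY : X * q - Y * p = 1) (i : Fin 2) (a : X0 (p * q)) : a ∈ curve p q X Y i ↔
      (∃ j, ∃ z ∈ geodesic (firstEnd p X i j) (secondEnd q Y i j), a = proj (p * q) (point z)) ∨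
      a = proj (p * q) (cusp (firstEnd p X i 0)) ∨
      a = proj (p * q) (cusp (secondEnd q Y i 0)) := by
  have hf := proj_firstEnd hp hq hpq hp2 hXY i
  have hs := proj_secondEnd hp hq hpq hp2 hq2 hXY i
  constructor
  · rintro ⟨_, (⟨z, hz, rfl⟩ | rfl | rfl) | (⟨z, hz, rfl⟩ | rfl | rfl), rfl⟩
    · exact Or.inl ⟨0, z, hz, rfl⟩
    · exact Or.inr (Or.inl rfl)
    · exact Or.inr (Or.inr rfl)
    · exact Or.inl ⟨1, z, hz, rfl⟩
    · exact Or.inr (Or.inl hf.symm)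
    · exact Or.inr (Or.inr hs.symm)
  · rintro (⟨j, z, hz, rfl⟩ | rfl | rfl)
    · have hj : j = 0 ∨ j = 1 := by omega
      rcases hj with rfl | rfl
      · exact ⟨_, Or.inl (Or.inl ⟨z, hz, rfl⟩), rfl⟩
      · exact ⟨_, Or.inr (Or.inl ⟨z, hz, rfl⟩), rfl⟩
    · exact ⟨_, Or.inl (Or.inr (Or.inl rfl)), rfl⟩
    · exact ⟨_, Or.inl (Or.inr (Or.inr rfl)), rfl⟩

lemma curve_inter_cusps (hp : p.Prime) (hq : q.Prime) (hpq : p ≠ q) (hp2 : p ≠ 2) (hq2 : q ≠ 2)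
    (hXY : X * q - Y * p = 1) (i : Fin 2) : curve p q X Y i ∩ cusps (p * q) =
      {proj (p * q) (cusp (firstEnd p X i 0)), proj (p * q) (cusp (secondEnd q Y i 0))} := by
  ext a
  rw [Set.mem_inter_iff, mem_curve_iff hp hq hpq hp2 hq2 hXY]
  constructor
  · rintro ⟨⟨j, z, -, rfl⟩ | h, c, hc⟩
    · exact absurd hc (proj_cusp_ne_point _ _)
    · exact h
  · rintro h
    refine ⟨Or.inr h, ?_⟩
    rcases h with rfl | rfl
    exacts [⟨_, rfl⟩, ⟨_, rfl⟩]

lemma fixSet_eq_union (hp : p.Prime) (hq : q.Prime) (hpq : p ≠ q) (hp2 : p ≠ 2) (hq2 : q ≠ 2)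
    (hXY : X * q - Y * p = 1) :
    fixSet (p * q) = curve p q X Y 0 ∪ curve p q X Y 1 := by
  have hunion : ∀ a i, a ∈ curve p q X Y i → a ∈ curve p q X Y 0 ∪ curve p q X Y 1 := by
    intro a i h
    have hi : i = 0 ∨ i = 1 := by omega
    rcases hi with rfl | rfl
    exacts [Or.inl h, Or.inr h]
  have hfix : ∀ i, curve p q X Y i ⊆ fixSet (p * q) := by
    intro i a ha
    rcases (mem_curve_iff hp hq hpq hp2 hq2 hXY i a).1 ha with ⟨j, z, hz, rfl⟩ | rfl | rfl
    · exact mem_fixSet_of_mem_geodesic hp hq hp2 hq2 hXY hz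
    · exact cusps_subset_fixSet hp hq hpq ⟨_, rfl⟩
    · exact cusps_subset_fixSet hp hq hpq ⟨_, rfl⟩
  refine Set.Subset.antisymm (fun a ha => ?_) (Set.union_subset (hfix 0) (hfix 1))
  obtain ⟨b, rfl⟩ : ∃ b, proj (p * q) b = a := Quotient.exists_rep a
  cases b with
  | point z =>
    obtain ⟨i, j, w, hw, he⟩ := exists_mem_geodesic_of_fixed hp hq hpq hp2 hq2 hXY ha
    exact hunion _ i ((mem_curve_iff hp hq hpq hp2 hq2 hXY i _).2 (Or.inl ⟨j, w, hw, he⟩))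
  | cusp c =>
    obtain ⟨i, hi⟩ := proj_cusp_cases hp hq hpq hXY c
    exact hunion _ i ((mem_curve_iff hp hq hpq hp2 hq2 hXY i _).2 (Or.inr hi))

lemma disjoint_curves (hp : p.Prime) (hq : q.Prime) (hpq : p ≠ q) (hp2 : p ≠ 2) (hq2 : q ≠ 2)
    (hXY : X * q - Y * p = 1) : Disjoint (curve p q X Y 0) (curve p q X Y 1) := by
  rw [Set.disjoint_left]
  intro a h0 h1
  rw [mem_curve_iff hp hq hpq hp2 hq2 hXY] at h0 h1
  rcases h0 with ⟨j, z, hz, rfl⟩ | rfl | rfl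
  · rcases h1 with ⟨l, w, hw, he⟩ | he | he
    · exact absurd (eq_of_mem_geodesics hp hq hp2 hq2 hXY hz hw he).1 zero_ne_one
    · exact proj_cusp_ne_point _ _ he.symm
    · exact proj_cusp_ne_point _ _ he.symm
  · rcases h1 with ⟨l, w, hw, he⟩ | he | he
    · exact proj_cusp_ne_point _ _ he
    · exact proj_firstEnd_injective hp hq hpq hXY he
    · exact proj_firstEnd_ne_secondEnd hp hq hpq hXY _ _ he
  · rcases h1 with ⟨l, w, hw, he⟩ | he | he
    · exact proj_cusp_ne_point _ _ he
    · exact proj_firstEnd_ne_secondEnd hp hq hpq hXY _ _ he.symm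
    · exact proj_secondEnd_injective hp hq hpq hXY he

lemma disjoint_geodesics (hp : p.Prime) (hq : q.Prime) (hp2 : p ≠ 2) (hq2 : q ≠ 2)
    (hXY : X * q - Y * p = 1) {i j k l : Fin 2} (hne : (i, j) ≠ (k, l)) :
    Disjoint (geodesic (firstEnd p X i j) (secondEnd q Y i j))
      (geodesic (firstEnd p X k l) (secondEnd q Y k l)) := by
  rw [Set.disjoint_left]
  intro z hz hw
  obtain ⟨rfl, rfl, -⟩ := eq_of_mem_geodesics hp hq hp2 hq2 hXY hz hw rfl
  exact hne rfl

lemma injOn_geodesics (hp : p.Prime) (hq : q.Prime) (hp2 : p ≠ 2) (hq2 : q ≠ 2)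
    (hXY : X * q - Y * p = 1) : Set.InjOn (fun z => proj (p * q) (point z))
      (⋃ i, ⋃ j, geodesic (firstEnd p X i j) (secondEnd q Y i j)) := by
  intro z hz w hw he
  simp only [Set.mem_iUnion] at hz hw
  obtain ⟨i, j, hz⟩ := hz
  obtain ⟨k, l, hw⟩ := hw
  exact (eq_of_mem_geodesics hp hq hp2 hq2 hXY hz hw he).2.2

lemma isSimpleClosedCurve_curve (hp : p.Prime) (hq : q.Prime) (hpq : p ≠ q) (hp2 : p ≠ 2)
    (hq2 : q ≠ 2) (hXY : X * q - Y * p = 1) (i : Fin 2) :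
    IsSimpleClosedCurve (curve p q X Y i) := by
  have hf := proj_firstEnd hp hq hpq hp2 hXY i
  have hs := proj_secondEnd hp hq hpq hp2 hq2 hXY i
  have hne := proj_firstEnd_ne_secondEnd hp hq hpq hXY i i
  have hdisj : Disjoint (geodesic (firstEnd p X i 0) (secondEnd q Y i 0))
      (geodesic (firstEnd p X i 1) (secondEnd q Y i 1)) :=
    disjoint_geodesics hp hq hp2 hq2 hXY (by simp)
  have hinj : Set.InjOn (fun z => proj (p * q) (point z))
      (geodesic (firstEnd p X i 0) (secondEnd q Y i 0) ∪
        geodesic (firstEnd p X i 1) (secondEnd q Y i 1)) := by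
    refine (injOn_geodesics hp hq hp2 hq2 hXY).mono (Set.union_subset ?_ ?_)
    · exact Set.subset_iUnion₂_of_subset i 0 subset_rfl
    · exact Set.subset_iUnion₂_of_subset i 1 subset_rfl
  have hi : i = 0 ∨ i = 1 := by omega
  rcases hi with rfl | rfl
  · exact isSimpleClosedCurve_of_geodesics (x := 1) (y := 0) (x' := 0) (y' := 1) (r := 1) (s := 0)
      (r' := 1) (s' := 2) (by norm_num) (by norm_num) hf hs hne hinj hdisj
  · exact isSimpleClosedCurve_of_geodesics (x := X) (y := p) (x' := Y) (y' := q) (r := 2 * X)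
      (s := p) (r' := 2 * Y) (s' := q) (by linarith) (by linarith) hf hs hne hinj hdisj

lemma firstEnd_ne_secondEnd (hXY : X * q - Y * p = 1) (i j : Fin 2) :
    firstEnd p X i j ≠ secondEnd q Y i j := by
  have hX : X ≠ 0 ∨ (p : ℤ) ≠ 0 := ne_zero_or_of_isCoprime (isCoprime_first hXY)
  have hY : Y ≠ 0 ∨ (q : ℤ) ≠ 0 := ne_zero_or_of_isCoprime (isCoprime_second hXY)
  have hX2 : 2 * X ≠ 0 ∨ (p : ℤ) ≠ 0 := hX.imp_left (mul_ne_zero two_ne_zero)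
  have hY2 : 2 * Y ≠ 0 ∨ (q : ℤ) ≠ 0 := hY.imp_left (mul_ne_zero two_ne_zero)
  revert i j
  simp only [Fin.forall_fin_two]
  refine ⟨⟨fun h => ?_, fun h => ?_⟩, fun h => ?_, fun h => ?_⟩
  · exact absurd ((cuspOf_eq_iff (x := 1) (y := 0) (x' := 0) (y' := 1) (by norm_num)
      (by norm_num)).1 h) (by norm_num)
  · exact absurd ((cuspOf_eq_iff (x := 1) (y := 0) (x' := 1) (y' := 2) (by norm_num)
      (by norm_num)).1 h) (by norm_num)
  · have := (cuspOf_eq_iff hX hY).1 h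
    omega
  · have := (cuspOf_eq_iff hX2 hY2).1 h
    linarith

end Configuration

end ModCurve

end

theorem lemma6p3 (p q : ℕ) (hp : p.Prime) (hq : q.Prime) (hp2 : p ≠ 2) (hq2 : q ≠ 2)
    (hpq : p ≠ q) :
    ∃ C : Fin 2 → Set (ModCurve.X0 (p * q)),
      -- (i) the fixed set is the disjoint union of two simple closed curves
      ModCurve.fixSet (p * q) = C 0 ∪ C 1 ∧
      Disjoint (C 0) (C 1) ∧
      (∀ i, ModCurve.IsSimpleClosedCurve (C i)) ∧
      -- each curve contains exactly two cusps, and there are no others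
      ModCurve.proj (p * q) (.cusp OnePoint.infty) ≠
        ModCurve.proj (p * q) (.cusp ((0 : ℚ) : OnePoint ℚ)) ∧
      ModCurve.proj (p * q) (.cusp ((1 / (p : ℚ) : ℚ) : OnePoint ℚ)) ≠
        ModCurve.proj (p * q) (.cusp ((1 / (q : ℚ) : ℚ) : OnePoint ℚ)) ∧
      C 0 ∩ ModCurve.cusps (p * q) =
        {ModCurve.proj (p * q) (.cusp OnePoint.infty),
          ModCurve.proj (p * q) (.cusp ((0 : ℚ) : OnePoint ℚ))} ∧
      C 1 ∩ ModCurve.cusps (p * q) =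
        {ModCurve.proj (p * q) (.cusp ((1 / (p : ℚ) : ℚ) : OnePoint ℚ)),
          ModCurve.proj (p * q) (.cusp ((1 / (q : ℚ) : ℚ) : OnePoint ℚ))} ∧
      ModCurve.cusps (p * q) ⊆ ModCurve.fixSet (p * q) ∧
      -- (ii) the pair of geodesics for the curve `C i` has endpoints `a i j`, `b i j`, `j = 0, 1`
      ∃ a b : Fin 2 → Fin 2 → OnePoint ℚ,
        (∀ i j, a i j ≠ b i j) ∧
        (∀ i j i' j', (i, j) ≠ (i', j') →
          Disjoint (ModCurve.geodesic (a i j) (b i j))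
            (ModCurve.geodesic (a i' j') (b i' j'))) ∧
        (∀ i, C i = ModCurve.proj (p * q) ''
          (ModCurve.closedGeodesic (a i 0) (b i 0) ∪
            ModCurve.closedGeodesic (a i 1) (b i 1))) ∧
        Set.InjOn (fun z => ModCurve.proj (p * q) (.point z))
          (⋃ i, ⋃ j, ModCurve.geodesic (a i j) (b i j)) ∧
        (∀ i, (∃ g ∈ CongruenceSubgroup.Gamma0 (p * q),
            ModCurve.moveCusp g (a i 0) = a i 1) ∧
          (∃ g ∈ CongruenceSubgroup.Gamma0 (p * q),
            ModCurve.moveCusp g (b i 0) = b i 1)) := by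
  have hcop : IsCoprime (q : ℤ) (p : ℤ) :=
    Nat.isCoprime_iff_coprime.2 ((Nat.coprime_primes hq hp).2 hpq.symm)
  obtain ⟨X, Z, hXZ⟩ := hcop
  have hXY : X * q - (-Z) * p = 1 := by linear_combination hXZ
  generalize -Z = Y at hXY
  have e_inf : (OnePoint.infty : OnePoint ℚ) = ModCurve.firstEnd p X 0 0 := rfl
  have e_zero : ((0 : ℚ) : OnePoint ℚ) = ModCurve.secondEnd q Y 0 0 := by
    simp [ModCurve.secondEnd, ModCurve.cuspOf]
  -- The geodesics end at `X / p` and `Y / q`, where the Bézout relation gives determinant one;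
  -- having the same denominators, these are equivalent to `1 / p` and `1 / q`.
  have e_p : ModCurve.proj (p * q) (.cusp ((1 / (p : ℚ) : ℚ) : OnePoint ℚ)) =
      ModCurve.proj (p * q) (.cusp (ModCurve.firstEnd p X 1 0)) := by
    have : ((1 / (p : ℚ) : ℚ) : OnePoint ℚ) = ModCurve.cuspOf 1 p := by
      simp [ModCurve.cuspOf, hp.ne_zero]
    rw [this]
    exact (ModCurve.proj_cuspOf_eq_iff hp hq hpq isCoprime_one_left
      (ModCurve.isCoprime_first hXY)).2 ⟨Iff.rfl, Iff.rfl⟩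
  have e_q : ModCurve.proj (p * q) (.cusp ((1 / (q : ℚ) : ℚ) : OnePoint ℚ)) =
      ModCurve.proj (p * q) (.cusp (ModCurve.secondEnd q Y 1 0)) := by
    have : ((1 / (q : ℚ) : ℚ) : OnePoint ℚ) = ModCurve.cuspOf 1 q := by
      simp [ModCurve.cuspOf, hq.ne_zero]
    rw [this]
    exact (ModCurve.proj_cuspOf_eq_iff hp hq hpq isCoprime_one_left
      (ModCurve.isCoprime_second hXY)).2 ⟨Iff.rfl, Iff.rfl⟩
  rw [e_p, e_q, e_zero, e_inf]
  have hne := ModCurve.proj_firstEnd_ne_secondEnd hp hq hpq hXY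
  refine ⟨ModCurve.curve p q X Y, ModCurve.fixSet_eq_union hp hq hpq hp2 hq2 hXY,
    ModCurve.disjoint_curves hp hq hpq hp2 hq2 hXY,
    ModCurve.isSimpleClosedCurve_curve hp hq hpq hp2 hq2 hXY, hne 0 0, hne 1 1,
    ModCurve.curve_inter_cusps hp hq hpq hp2 hq2 hXY 0,
    ModCurve.curve_inter_cusps hp hq hpq hp2 hq2 hXY 1,
    ModCurve.cusps_subset_fixSet hp hq hpq, ModCurve.firstEnd p X, ModCurve.secondEnd q Y,
    ModCurve.firstEnd_ne_secondEnd hXY,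
    fun i j k l h => ModCurve.disjoint_geodesics hp hq hp2 hq2 hXY h, fun i => rfl,
    ModCurve.injOn_geodesics hp hq hp2 hq2 hXY, fun i => ⟨?_, ?_⟩⟩
  · exact ModCurve.proj_cusp_eq_iff.1 (ModCurve.proj_firstEnd hp hq hpq hp2 hXY i).symm
  · exact ModCurve.proj_cusp_eq_iff.1 (ModCurve.proj_secondEnd hp hq hpq hp2 hq2 hXY i).symm
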